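/- Let $\Omega$ be a finite set, let $\Theta\subset\mathbf{R}^k$ be compact with interior $\Theta^{o}$, and let $\{p_\theta\}_{\theta\in\Theta}$ be a family of probability distributions on $\Omega$ such that for every $x\in\Omega$ the map $\theta\mapsto p_\theta(x)$ is continuous on $\Theta$ and three times differentiable on $\Theta^{o}$. Write $P_\theta^{(N)}$ for the $N$-fold product of $p_\theta$ on $\Omega^N$. Let $\Delta:\Theta\times\Theta\to\mathbf{R}$ be a pseudo-distance, i.e. $\Delta(a,b)\ge 0$ for all $a,b$, and $\Delta(a,b)=0$ if and only if $a=b$, and assume that $s\mapsto\Delta(s,t)$ is continuous on $\Theta$ for each $t\in\Theta$. Let $\theta\in\Theta^{o}$ be such that every $x\in\Omega$ satisfies $p_\theta(x)>0$ or $p_{t}(x)=0$ for all $t$ in a neighbourhood of $\theta$. Assume that $s\mapsto\Delta(s,\theta)$ is $C^2$ near $\theta$, and that the same point Hesse matrix $H_\theta=[\partial_{s^\alpha}\partial_{s^\beta}\Delta(s,\theta)|_{s=\theta}]_{\alpha\beta}$ is non-zero. Let $F_\theta=\sum_{x:\,p_\theta(x)>0}p_\theta(x)[\nabla_\theta\log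 p_\theta(x)][\nabla_\theta\log p_\theta(x)]^{T}$ be the Fisher matrix and $F_\theta^{-1}$ its Moore-Penrose inverse (the inverse matrix when $F_\theta$ is non-singular), and let $\sigma_1(A)$ be the maximal eigenvalue of a real symmetric matrix $A$. Put $\log 0=-\infty$ and $1/0=+\infty$. An estimator is a sequence of maps $\theta^{\mathrm{est}}_N:\Omega^N\to\Theta$. It is called consistent if $P^{(N)}_{t}(\Delta(\theta^{\mathrm{est}}_N,t)>\delta)\to 0$ as $N\to\infty$ for all $t\in\Theta^{o}$ and $\delta>0$. A maximum likelihood estimator $\theta^{\mathrm{ml}}$ is an estimator such that $\theta^{\mathrm{ml}}_N(x^N)$ maximizes $t\mapsto\prod_{i=1}^{N}p_t(x_i)$ over $\Theta$, for all $N$ and $x^N\in\Omega^N$. (1) Every consistent estimator $\theta^{\mathrm{est}}$ satisfies $$\varliminf_{\epsilon\to0}\varliminf_{N\to\infty}\frac{1}{\epsilon^2N}\log P^{(N)}_\theta\bigl(\Delta(\theta^{\mathrm{est}}_N,\theta)>\epsilon^2\bigr)\ \ge\ -1/\sigma_1\bigl(\sqrt{H_\theta}F_\theta^{-1}\sqrt{H_\theta}\bigr).$$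 (2) Suppose that the identifiability condition holds: for all $t\in\Theta^{o}$ and $t'\in\Theta$ with $t\ne t'$ there is an $x\in\Omega$ with $p_t(x)\neq p_{t'}(x)$. Then every maximum likelihood estimator $\theta^{\mathrm{ml}}$ is consistent and, if $F_\theta$ is non-singular, $$\lim_{\epsilon\to0}\lim_{N\to\infty}\frac{1}{\epsilon^2N}\log P^{(N)}_\theta\bigl(\Delta(\theta^{\mathrm{ml}}_N,\theta)>\epsilon^2\bigr)\ =\ -1/\sigma_1\bigl(\sqrt{H_\theta}F_\theta^{-1}\sqrt{H_\theta}\bigr),$$ where the inner limit exists for all sufficiently small $\epsilon>0$. -/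

import Mathlib

open Filter Topology

namespace ErrorExponent

/-- `f` is three times (Fréchet) differentiable on the open set `U`: the derivatives of order
`0`, `1` and `2` are differentiable on `U`. -/
def ThriceDifferentiableOn {k : ℕ} (f : EuclideanSpace ℝ (Fin k) → ℝ)
    (U : Set (EuclideanSpace ℝ (Fin k))) : Prop :=
  ∀ m : ℕ, m ≤ 2 → DifferentiableOn ℝ (iteratedFDeriv ℝ m f) U

/-- A smooth parametric family `p θ`, `θ ∈ Θ`, of probability distributions on the finite sample
space `Ω`. Only the values `p θ x` with `θ ∈ Θ` matter. -/
structure IsSmoothModel {k : ℕ} {Ω : Type*} [Fintype Ω] (Θ : Set (EuclideanSpace ℝ (Fin k)))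
    (p : EuclideanSpace ℝ (Fin k) → Ω → ℝ) : Prop where
  nonneg : ∀ θ ∈ Θ, ∀ x, 0 ≤ p θ x
  sum_eq_one : ∀ θ ∈ Θ, ∑ x, p θ x = 1
  continuousOn : ∀ x, ContinuousOn (fun θ => p θ x) Θ
  thriceDifferentiableOn : ∀ x, ThriceDifferentiableOn (fun θ => p θ x) (interior Θ)

/-- A pseudo-distance on `Θ`: nonnegative, and zero exactly on the diagonal. Neither symmetry nor
the triangle inequality is required. Only the values on `Θ × Θ` matter. -/
structure IsPseudoDistanceOn {k : ℕ} (Θ : Set (EuclideanSpace ℝ (Fin k)))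
    (Δ : EuclideanSpace ℝ (Fin k) → EuclideanSpace ℝ (Fin k) → ℝ) : Prop where
  nonneg : ∀ a ∈ Θ, ∀ b ∈ Θ, 0 ≤ Δ a b
  self_eq_zero : ∀ a ∈ Θ, Δ a a = 0
  eq_of_eq_zero : ∀ a ∈ Θ, ∀ b ∈ Θ, Δ a b = 0 → a = b

/-- The identifiability condition. -/
def Identifiable {k : ℕ} {Ω : Type*} (Θ : Set (EuclideanSpace ℝ (Fin k)))
    (p : EuclideanSpace ℝ (Fin k) → Ω → ℝ) : Prop :=
  ∀ θ ∈ interior Θ, ∀ θ' ∈ Θ, θ ≠ θ' → ∃ x, p θ x ≠ p θ' x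

/-- An estimator of the parameter: for each number `N` of trials a map from `Ω ^ N` to `Θ`. -/
def IsEstimator {k : ℕ} {Ω : Type*} (Θ : Set (EuclideanSpace ℝ (Fin k)))
    (est : (N : ℕ) → (Fin N → Ω) → EuclideanSpace ℝ (Fin k)) : Prop :=
  ∀ (N : ℕ) (x : Fin N → Ω), est N x ∈ Θ

/-- A maximum likelihood estimator: every estimate is a point of `Θ` at which the likelihood of
the observed sequence is maximal. -/
def IsMaxLikelihoodEstimator {k : ℕ} {Ω : Type*} (Θ : Set (EuclideanSpace ℝ (Fin k)))
    (p : EuclideanSpace ℝ (Fin k) → Ω → ℝ)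
    (est : (N : ℕ) → (Fin N → Ω) → EuclideanSpace ℝ (Fin k)) : Prop :=
  ∀ (N : ℕ) (x : Fin N → Ω), est N x ∈ Θ ∧
    ∀ t ∈ Θ, ∏ i, p t (x i) ≤ ∏ i, p (est N x) (x i)

open Classical in
/-- The error probability with threshold `δ` after `N` independent trials: the probability, under
the `N`-fold product of `p θ`, of the sequences whose estimate has loss greater than `δ`. -/
noncomputable def errorProb {k : ℕ} {Ω : Type*} [Fintype Ω]
    (p : EuclideanSpace ℝ (Fin k) → Ω → ℝ)
    (Δ : EuclideanSpace ℝ (Fin k) → EuclideanSpace ℝ (Fin k) → ℝ)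
    (est : (N : ℕ) → (Fin N → Ω) → EuclideanSpace ℝ (Fin k))
    (θ : EuclideanSpace ℝ (Fin k)) (δ : ℝ) (N : ℕ) : ℝ :=
  ∑ x : Fin N → Ω with δ < Δ (est N x) θ, ∏ i, p θ (x i)

/-- (Weak) consistency in the loss function `Δ`, at every interior parameter. -/
def IsConsistent {k : ℕ} {Ω : Type*} [Fintype Ω] (Θ : Set (EuclideanSpace ℝ (Fin k)))
    (p : EuclideanSpace ℝ (Fin k) → Ω → ℝ)
    (Δ : EuclideanSpace ℝ (Fin k) → EuclideanSpace ℝ (Fin k) → ℝ)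
    (est : (N : ℕ) → (Fin N → Ω) → EuclideanSpace ℝ (Fin k)) : Prop :=
  ∀ θ ∈ interior Θ, ∀ δ : ℝ, 0 < δ →
    Tendsto (fun N : ℕ => errorProb p Δ est θ δ N) atTop (𝓝 0)

/-- The normalized logarithm `(ε² N)⁻¹ log P(Δ(est, θ) > ε²)`, with `log 0 = -∞`. -/
noncomputable def scaledLogError {k : ℕ} {Ω : Type*} [Fintype Ω]
    (p : EuclideanSpace ℝ (Fin k) → Ω → ℝ)
    (Δ : EuclideanSpace ℝ (Fin k) → EuclideanSpace ℝ (Fin k) → ℝ)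
    (est : (N : ℕ) → (Fin N → Ω) → EuclideanSpace ℝ (Fin k))
    (θ : EuclideanSpace ℝ (Fin k)) (ε : ℝ) (N : ℕ) : EReal :=
  ((1 / (ε ^ 2 * N) : ℝ) : EReal) *
    ENNReal.log (ENNReal.ofReal (errorProb p Δ est θ (ε ^ 2) N))

/-- The partial derivative of `f` in the `i`-th coordinate. -/
noncomputable def partialDeriv {k : ℕ} (i : Fin k) (f : EuclideanSpace ℝ (Fin k) → ℝ)
    (θ : EuclideanSpace ℝ (Fin k)) : ℝ :=
  fderiv ℝ f θ (EuclideanSpace.single i 1)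

/-- The Fisher matrix `∑ x, p θ x • (∇ log p θ x) (∇ log p θ x)ᵀ`. -/
noncomputable def fisherMatrix {k : ℕ} {Ω : Type*} [Fintype Ω]
    (p : EuclideanSpace ℝ (Fin k) → Ω → ℝ) (θ : EuclideanSpace ℝ (Fin k)) :
    Matrix (Fin k) (Fin k) ℝ :=
  Matrix.of fun i j => ∑ x, p θ x *
    (partialDeriv i (fun t => Real.log (p t x)) θ * partialDeriv j (fun t => Real.log (p t x)) θ)

/-- The same point Hesse matrix: the Hesse matrix of `t ↦ Δ t θ` at `t = θ`. -/
noncomputable def hesseMatrix {k : ℕ}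
    (Δ : EuclideanSpace ℝ (Fin k) → EuclideanSpace ℝ (Fin k) → ℝ)
    (θ : EuclideanSpace ℝ (Fin k)) : Matrix (Fin k) (Fin k) ℝ :=
  Matrix.of fun i j => partialDeriv i (partialDeriv j (fun t => Δ t θ)) θ

/-- The square root of a positive semidefinite matrix. -/
noncomputable def matrixSqrt {k : ℕ} (A : Matrix (Fin k) (Fin k) ℝ) :
    Matrix (Fin k) (Fin k) ℝ :=
  cfc Real.sqrt A

/-- The Moore-Penrose inverse of a symmetric matrix: nonzero eigenvalues are inverted, the
eigenvalue `0` is kept. For an invertible symmetric matrix this is the inverse matrix. -/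
noncomputable def pseudoInverse {k : ℕ} (A : Matrix (Fin k) (Fin k) ℝ) :
    Matrix (Fin k) (Fin k) ℝ :=
  cfc (fun r : ℝ => r⁻¹) A

/-- The maximal eigenvalue of a symmetric matrix (of positive size). -/
noncomputable def maxEigenvalue {k : ℕ} (A : Matrix (Fin k) (Fin k) ℝ) : ℝ :=
  sSup (spectrum ℝ A)

/-- The bound `-1 / σ₁(√H F⁻¹ √H)`, as an extended real number (with `1 / 0 = ∞`). -/
noncomputable def exponentBound {k : ℕ} (H F : Matrix (Fin k) (Fin k) ℝ) : EReal :=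
  -(((ENNReal.ofReal (maxEigenvalue (matrixSqrt H * pseudoInverse F * matrixSqrt H)))⁻¹ :
    ENNReal) : EReal)

end ErrorExponent

/-! Both parts are large-deviation estimates in which everything becomes quadratic at scale `ε`.
Since `θ` is an interior minimum of `Δ · θ`, the loss at `θ + ε v` is about `ε² H(v) / 2`, while
`D(p_{θ+εv} ‖ p_θ)` is about `ε² F(v) / 2`; here `H(v)` and `F(v)` are the quadratic forms of the
Hesse and Fisher matrices. Minimizing `F(v) / 2` under `H(v) / 2 ≥ 1` gives `1 / σ`, with `σ` the
top eigenvalue of `√H F⁻¹ √H`.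

Lower bound: if `Δ t θ > ε²`, a consistent estimator makes the error event likely under `p t`, and a
change of measure (`eventually_exp_le_seqProb`) costs only `exp (-N D(p_t ‖ p_θ))`. The best
direction comes from a top eigenvector (`exists_quadForm_eq`); this also works for singular `F`.

Upper bound for maximum likelihood: counting types (`seqProb_le_of_le_relEntropy`) reduces the claim
to a lower bound on `D(q ‖ p_θ)` over the empirical distributions `q` that cause an error. Atypical
`q` have a fixed exponential cost, negligible against `ε²`. For `q` near `p_θ` the log-likelihood is
strongly concave near `θ`, so the maximizer `s` beats `θ` by almost `F(s - θ) / 2`, and Gibbs'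
inequality bounds this gain by `D(q ‖ p_θ)` (`IsGoodScale.half_fisherForm_le_relEntropy`). A
Rayleigh quotient bound turns `Δ s θ > ε²` into a lower bound on `F(s - θ)`.

The inner limit exists because the infimum of `D(q ‖ p_θ)` over `errorTypes` is the exact exponent:
type counting gives one inequality, and a change of measure to `q` itself gives the other, the
maximizer being stable under small changes of `q` (`IsGoodScale.tendsto_seqProb_not`). -/

namespace ErrorExponent

/-! ### Product measures, types and large deviations -/

section Sequences

variable {Ω : Type*} [Fintype Ω]

open Classical in
/-- The probability of an event under the `N`-fold product of `q`. -/
noncomputable def seqProb (q : Ω → ℝ) (N : ℕ) (A : (Fin N → Ω) → Prop) : ℝ :=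
  ∑ x : Fin N → Ω with A x, ∏ i, q (x i)

open Classical in
/-- The empirical distribution of a sequence. -/
noncomputable def freq {N : ℕ} (x : Fin N → Ω) (a : Ω) : ℝ :=
  (Finset.card {i | x i = a} : ℝ) / N

/-- The relative entropy of `q` with respect to `p`; meaningful when `q` is supported in the
support of `p`. -/
noncomputable def relEntropy (q p : Ω → ℝ) : ℝ := ∑ a, q a * Real.log (q a / p a)

omit [Fintype Ω] in
theorem prod_nonneg_of_nonneg {q : Ω → ℝ} (hq : ∀ a, 0 ≤ q a) {N : ℕ} (x : Fin N → Ω) :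
    0 ≤ ∏ i, q (x i) :=
  Finset.prod_nonneg fun _ _ => hq _

theorem seqProb_nonneg {q : Ω → ℝ} (hq : ∀ a, 0 ≤ q a) (N : ℕ) (A : (Fin N → Ω) → Prop) :
    0 ≤ seqProb q N A :=
  Finset.sum_nonneg fun x _ => prod_nonneg_of_nonneg hq x

theorem seqProb_true (q : Ω → ℝ) (N : ℕ) : seqProb q N (fun _ => True) = (∑ a, q a) ^ N := by
  classical
  have := Fintype.sum_pow (f := q) N
  simp [seqProb, this]

/-- Monotonicity of probabilities; sequences of probability zero may be disregarded. -/
theorem seqProb_mono {q : Ω → ℝ} (hq : ∀ a, 0 ≤ q a) {N : ℕ} {A B : (Fin N → Ω) → Prop}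
    (h : ∀ x, (∀ i, 0 < q (x i)) → A x → B x) : seqProb q N A ≤ seqProb q N B := by
  classical
  unfold seqProb
  rw [Finset.sum_filter, Finset.sum_filter]
  refine Finset.sum_le_sum fun x _ => ?_
  by_cases hx : ∀ i, 0 < q (x i)
  · by_cases hA : A x
    · simp [hA, h x hx hA]
    · simp only [hA, if_false]
      split_ifs
      · exact prod_nonneg_of_nonneg hq x
      · exact le_rfl
  · push Not at hx
    obtain ⟨i, hi⟩ := hx
    have : ∏ i, q (x i) = 0 := Finset.prod_eq_zero (Finset.mem_univ i) (le_antisymm hi (hq _))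
    simp [this]

theorem seqProb_le_one {q : Ω → ℝ} (hq : q ∈ stdSimplex ℝ Ω) (N : ℕ)
    (A : (Fin N → Ω) → Prop) : seqProb q N A ≤ 1 := by
  have h := seqProb_mono hq.1 (A := A) (B := fun _ => True) (N := N) (by simp)
  rwa [seqProb_true, hq.2, one_pow] at h

theorem seqProb_or_le {q : Ω → ℝ} (hq : ∀ a, 0 ≤ q a) {N : ℕ} (A B : (Fin N → Ω) → Prop) :
    seqProb q N (fun x => A x ∨ B x) ≤ seqProb q N A + seqProb q N B := by
  classical
  unfold seqProb
  rw [Finset.sum_filter, Finset.sum_filter, Finset.sum_filter, ← Finset.sum_add_distrib]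
  refine Finset.sum_le_sum fun x _ => ?_
  have := prod_nonneg_of_nonneg hq x
  by_cases hA : A x <;> by_cases hB : B x <;> simp [hA, hB, this]

theorem seqProb_add_seqProb_not {q : Ω → ℝ} (hq : q ∈ stdSimplex ℝ Ω) {N : ℕ}
    (A : (Fin N → Ω) → Prop) : seqProb q N A + seqProb q N (fun x => ¬ A x) = 1 := by
  classical
  have := seqProb_true q N
  rw [hq.2, one_pow] at this
  rw [← this]
  simp only [seqProb, Finset.filter_true]
  exact Finset.sum_filter_add_sum_filter_not _ _ _

theorem seqProb_exists_le {q : Ω → ℝ} (hq : ∀ a, 0 ≤ q a) {ι : Type*} [Fintype ι] {N : ℕ}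
    (A : ι → (Fin N → Ω) → Prop) :
    seqProb q N (fun x => ∃ j, A j x) ≤ ∑ j, seqProb q N (A j) := by
  classical
  unfold seqProb
  simp only [Finset.sum_filter]
  rw [Finset.sum_comm]
  refine Finset.sum_le_sum fun x _ => ?_
  have hx := prod_nonneg_of_nonneg hq x
  split_ifs with h
  · obtain ⟨j, hj⟩ := h
    refine le_trans ?_ (Finset.single_le_sum (f := fun j => if A j x then ∏ i, q (x i) else 0)
      (fun j _ => ?_) (Finset.mem_univ j))
    · simp [hj]
    · split_ifs <;> simp [hx]
  · exact Finset.sum_nonneg fun j _ => by split_ifs <;> simp [hx]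

/-- A Chernoff bound. -/
theorem exists_seqProb_sum_nonneg_le {q : Ω → ℝ} (hq : q ∈ stdSimplex ℝ Ω) {g : Ω → ℝ}
    (hg : ∑ a, q a * g a < 0) :
    ∃ c > 0, ∀ N : ℕ, seqProb q N (fun x => 0 ≤ ∑ i, g (x i)) ≤ Real.exp (-(c * N)) := by
  classical
  -- The moment generating function equals `1` at `0` with negative slope, so it is below `1` at
  -- some `t > 0`; the rate is minus its logarithm there.
  have hderiv : HasDerivAt (fun t : ℝ => ∑ a, q a * Real.exp (t * g a)) (∑ a, q a * g a) 0 := by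
    have := HasDerivAt.fun_sum (u := Finset.univ) (x := (0 : ℝ))
      (A := fun a t => q a * Real.exp (t * g a)) (A' := fun a => q a * g a) fun a _ => by
        have := ((hasDerivAt_id (0 : ℝ)).mul_const (g a)).exp.const_mul (q a)
        simpa using this
    exact this
  have hev := hderiv.tendsto_slope_zero_right.eventually (gt_mem_nhds hg)
  obtain ⟨t, ht, ht0⟩ := (hev.and self_mem_nhdsWithin).exists
  have ht0 : 0 < t := ht0
  simp only [zero_add, zero_mul, Real.exp_zero, mul_one, hq.2, smul_eq_mul] at ht
  have hlt : ∑ a, q a * Real.exp (t * g a) < 1 := by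
    by_contra hcon
    have := mul_nonneg (inv_nonneg.2 ht0.le) (sub_nonneg.2 (not_lt.1 hcon))
    linarith
  have hpos : 0 < ∑ a, q a * Real.exp (t * g a) := by
    have hne : ∃ a, 0 < q a := by
      by_contra! hcon
      have : ∑ a, q a ≤ 0 := Finset.sum_nonpos fun a _ => hcon a
      linarith [hq.2]
    obtain ⟨a, ha⟩ := hne
    exact Finset.sum_pos' (fun a _ => mul_nonneg (hq.1 a) (Real.exp_pos _).le)
      ⟨a, Finset.mem_univ a, mul_pos ha (Real.exp_pos _)⟩
  refine ⟨-Real.log (∑ a, q a * Real.exp (t * g a)), by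
    linarith [Real.log_neg hpos hlt], fun N => ?_⟩
  have h1 : Real.exp (-(-Real.log (∑ a, q a * Real.exp (t * g a)) * N)) =
      (∑ a, q a * Real.exp (t * g a)) ^ N := by
    rw [neg_mul, neg_neg, mul_comm, Real.exp_nat_mul, Real.exp_log hpos]
  rw [h1, Fintype.sum_pow]
  unfold seqProb
  rw [Finset.sum_filter]
  refine Finset.sum_le_sum fun x _ => ?_
  rw [Finset.prod_mul_distrib, ← Real.exp_sum, ← Finset.mul_sum]
  have hx := prod_nonneg_of_nonneg hq.1 x
  split_ifs with h
  · exact le_mul_of_one_le_right hx (Real.one_le_exp (mul_nonneg ht0.le h))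
  · exact mul_nonneg hx (Real.exp_pos _).le

theorem sum_apply_eq_freq {N : ℕ} (x : Fin N → Ω) (g : Ω → ℝ) :
    ∑ i, g (x i) = N * ∑ a, freq x a * g a := by
  classical
  rcases Nat.eq_zero_or_pos N with rfl | hN
  · simp
  have hN' : (N : ℝ) ≠ 0 := by positivity
  rw [← Finset.sum_fiberwise (s := Finset.univ) (g := x), Finset.mul_sum]
  refine Finset.sum_congr rfl fun a _ => ?_
  rw [Finset.sum_congr rfl (g := fun _ => g a) (by
    intro i hi; rw [(Finset.mem_filter.1 hi).2]), Finset.sum_const, nsmul_eq_mul, freq]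
  field_simp

theorem freq_mem_stdSimplex {N : ℕ} (hN : 0 < N) (x : Fin N → Ω) : freq x ∈ stdSimplex ℝ Ω := by
  classical
  refine ⟨fun a => by unfold freq; positivity, ?_⟩
  have := sum_apply_eq_freq x (fun _ => 1)
  have hN' : (N : ℝ) ≠ 0 := by positivity
  simp only [Finset.sum_const, Finset.card_univ, Fintype.card_fin, mul_one, nsmul_eq_mul] at this
  field_simp at this
  linarith

omit [Fintype Ω] in
theorem freq_eq_zero_of_forall_ne {N : ℕ} {x : Fin N → Ω} {a : Ω} (h : ∀ i, x i ≠ a) :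
    freq x a = 0 := by
  classical
  simp [freq, h]

omit [Fintype Ω] in
theorem freq_apply_pos {N : ℕ} (x : Fin N → Ω) (i : Fin N) : 0 < freq x (x i) := by
  classical
  have hN : 0 < N := i.pos
  have : 0 < Finset.card {j | x j = x i} := Finset.card_pos.2 ⟨i, by simp⟩
  unfold freq
  exact div_pos (by convert (Nat.cast_pos (α := ℝ)).2 this) (by exact_mod_cast hN)

omit [Fintype Ω] in
theorem freq_eq_zero_of_pos {N : ℕ} {q : Ω → ℝ} {x : Fin N → Ω} (h : ∀ i, 0 < q (x i)) {a : Ω}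
    (ha : q a = 0) : freq x a = 0 :=
  freq_eq_zero_of_forall_ne fun i hi => by have := h i; rw [hi, ha] at this; exact this.false

/-- Empirical distributions are exponentially unlikely to be away from the true one. -/
theorem exists_seqProb_far_le {q : Ω → ℝ} (hq : q ∈ stdSimplex ℝ Ω) {η : ℝ} (hη : 0 < η) :
    ∃ c > 0, ∃ C : ℝ, ∀ N : ℕ,
      seqProb q N (fun x => ∃ a, η ≤ |freq x a - q a|) ≤ C * Real.exp (-(c * N)) := by
  classical
  -- The mean is `-η`. The signs `s = 1` and `s = -1` treat the two tails of each letter frequency.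
  have key : ∀ (s : ℝ) (a : Ω), ∑ b, q b * (s * ((if b = a then 1 else 0) - q a) - η) < 0 := by
    intro s a
    have : ∑ b, q b * (s * ((if b = a then 1 else 0) - q a) - η)
        = s * (q a - (∑ b, q b) * q a) - (∑ b, q b) * η := by
      rw [Finset.sum_mul, Finset.sum_mul, mul_sub, Finset.mul_sum]
      have h1 : s * q a = ∑ b, q b * (s * (if b = a then 1 else 0)) := by
        simp [mul_comm]
      rw [h1, ← Finset.sum_sub_distrib, ← Finset.sum_sub_distrib]
      exact Finset.sum_congr rfl fun b _ => by ring
    rw [this, hq.2]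
    linarith
  choose c hc0 hc using fun (s : ℝ) (a : Ω) => exists_seqProb_sum_nonneg_le hq (key s a)
  have hc' : ∃ c0 > 0, ∀ a, c0 ≤ c 1 a ∧ c0 ≤ c (-1) a := by
    have hne : (Finset.univ : Finset Ω).Nonempty := by
      by_contra hcon
      have := hq.2
      rw [Finset.not_nonempty_iff_eq_empty.1 hcon] at this
      simp at this
    refine ⟨Finset.univ.inf' hne (fun a => min (c 1 a) (c (-1) a)), ?_, fun a => ?_⟩
    · rw [gt_iff_lt, Finset.lt_inf'_iff]
      exact fun a _ => lt_min (hc0 _ _) (hc0 _ _)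
    · exact le_min_iff.1 (Finset.inf'_le _ (Finset.mem_univ a))
  obtain ⟨c0, hc0p, hc0le⟩ := hc'
  refine ⟨c0, hc0p, Fintype.card Ω * 2, fun N => ?_⟩
  have hsum : ∀ (s : ℝ) (a : Ω) (x : Fin N → Ω),
      ∑ i, (s * ((if x i = a then 1 else 0) - q a) - η) = N * (s * (freq x a - q a) - η) := by
    intro s a x
    have h1 := sum_apply_eq_freq x (fun b => if b = a then (1 : ℝ) else 0)
    simp only [mul_ite, mul_one, mul_zero, Finset.sum_ite_eq', Finset.mem_univ, if_true] at h1
    rw [Finset.sum_sub_distrib, ← Finset.mul_sum, Finset.sum_sub_distrib, h1]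
    simp
    ring
  refine (seqProb_exists_le hq.1 _).trans ?_
  have : ∀ a, seqProb q N (fun x => η ≤ |freq x a - q a|) ≤ 2 * Real.exp (-(c0 * N)) := by
    intro a
    have hle : ∀ s : ℝ, c0 ≤ c s a → Real.exp (-(c s a * N)) ≤ Real.exp (-(c0 * N)) := by
      intro s hs
      apply Real.exp_le_exp.2
      have := mul_le_mul_of_nonneg_right hs (Nat.cast_nonneg (α := ℝ) N)
      linarith
    have h1 := (hc 1 a N).trans (hle 1 (hc0le a).1)
    have h2 := (hc (-1) a N).trans (hle (-1) (hc0le a).2)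
    have h3 : seqProb q N (fun x => η ≤ |freq x a - q a|) ≤ _ :=
      (seqProb_mono hq.1 (fun x _ hx => ?_)).trans (seqProb_or_le hq.1
        (fun x => 0 ≤ ∑ i, (1 * ((if x i = a then 1 else 0) - q a) - η))
        (fun x => 0 ≤ ∑ i, (-1 * ((if x i = a then 1 else 0) - q a) - η)))
    · linarith
    · simp only [hsum]
      rcases le_abs.1 hx with h | h
      · exact Or.inl (mul_nonneg (Nat.cast_nonneg _) (by linarith))
      · exact Or.inr (mul_nonneg (Nat.cast_nonneg _) (by linarith))
  calc _ ≤ ∑ a : Ω, 2 * Real.exp (-(c0 * N)) := Finset.sum_le_sum fun a _ => this a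
    _ = _ := by simp [mul_assoc]

theorem tendsto_exp_neg_mul_nat {c : ℝ} (hc : 0 < c) :
    Tendsto (fun N : ℕ => Real.exp (-(c * N))) atTop (𝓝 0) :=
  Real.tendsto_exp_neg_atTop_nhds_zero.comp
    (tendsto_natCast_atTop_atTop.const_mul_atTop hc)

theorem tendsto_seqProb_far {q : Ω → ℝ} (hq : q ∈ stdSimplex ℝ Ω) {η : ℝ} (hη : 0 < η) :
    Tendsto (fun N => seqProb q N (fun x => ∃ a, η ≤ |freq x a - q a|)) atTop (𝓝 0) := by
  obtain ⟨c, hc, C, h⟩ := exists_seqProb_far_le hq hη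
  refine squeeze_zero (fun N => seqProb_nonneg hq.1 N _) h ?_
  simpa using (tendsto_exp_neg_mul_nat hc).const_mul C

/-- Change of measure: an event that is likely under `q` has `p`-probability at least
`exp (-N D(q‖p))`, to first order in the exponent. -/
theorem eventually_exp_le_seqProb {q p : Ω → ℝ} (hq : q ∈ stdSimplex ℝ Ω)
    (hp : p ∈ stdSimplex ℝ Ω) (hqp : ∀ a, p a = 0 → q a = 0)
    {A : (N : ℕ) → (Fin N → Ω) → Prop}
    (hA : Tendsto (fun N => seqProb q N (fun x => ¬ A N x)) atTop (𝓝 0)) {E : ℝ}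
    (hE : relEntropy q p < E) :
    ∀ᶠ N : ℕ in atTop, Real.exp (-(E * N)) ≤ seqProb p N (A N) := by
  classical
  obtain ⟨E', hE', hE'E⟩ := exists_between hE
  -- Log-likelihood ratio minus `E'`, of negative mean under `q`: typically the density of `q` over
  -- `p` is below `exp (E' N)`. The gap `E - E'` later absorbs the factor `1 / 2`.
  set g : Ω → ℝ := fun a => Real.log (q a / p a) - E' with hg
  have hgneg : ∑ a, q a * g a < 0 := by
    have : ∑ a, q a * g a = relEntropy q p - (∑ a, q a) * E' := by
      rw [relEntropy, Finset.sum_mul, ← Finset.sum_sub_distrib]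
      exact Finset.sum_congr rfl fun a _ => by rw [hg]; ring
    rw [this, hq.2]; linarith
  obtain ⟨c, hc, hcN⟩ := exists_seqProb_sum_nonneg_le hq hgneg
  have hlim : Tendsto (fun N : ℕ => Real.exp (-(c * N)) + seqProb q N (fun x => ¬ A N x))
      atTop (𝓝 0) := by
    simpa using (tendsto_exp_neg_mul_nat hc).add hA
  have hlim2 := tendsto_exp_neg_mul_nat (sub_pos.2 hE'E)
  filter_upwards [hlim.eventually (gt_mem_nhds (show (0 : ℝ) < 1 / 2 by norm_num)),
    hlim2.eventually (gt_mem_nhds (show (0 : ℝ) < 1 / 2 by norm_num))] with N h1 h2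
  have hhalf : 1 / 2 ≤ seqProb q N (fun x => A N x ∧ ¬ 0 ≤ ∑ i, g (x i)) := by
    have e1 := seqProb_add_seqProb_not hq (fun x => A N x ∧ ¬ 0 ≤ ∑ i, g (x i))
    have e2 : seqProb q N (fun x => ¬ (A N x ∧ ¬ 0 ≤ ∑ i, g (x i))) ≤ _ :=
      (seqProb_mono hq.1 (fun x _ hx => by tauto)).trans (seqProb_or_le hq.1
        (fun x => 0 ≤ ∑ i, g (x i)) (fun x => ¬ A N x))
    have e3 := hcN N
    linarith
  have hcm : Real.exp (-(E' * N)) * seqProb q N (fun x => A N x ∧ ¬ 0 ≤ ∑ i, g (x i))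
      ≤ seqProb p N (A N) := by
    unfold seqProb
    rw [Finset.sum_filter, Finset.sum_filter, Finset.mul_sum]
    refine Finset.sum_le_sum fun x _ => ?_
    have hpx := prod_nonneg_of_nonneg hp.1 x
    by_cases hx : A N x ∧ ¬ 0 ≤ ∑ i, g (x i)
    · rw [if_pos hx, if_pos hx.1]
      by_cases hqx : ∀ i, 0 < q (x i)
      · have hp' : ∀ i, 0 < p (x i) := fun i => lt_of_le_of_ne (hp.1 _) fun h =>
          (hqx i).ne' (hqp _ h.symm)
        have e : ∀ i, p (x i) = Real.exp (-g (x i)) * (Real.exp (-E') * q (x i)) := by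
          intro i
          rw [← mul_assoc, ← Real.exp_add]
          have : -g (x i) + -E' = -Real.log (q (x i) / p (x i)) := by simp only [hg]; ring
          rw [this, Real.exp_neg, Real.exp_log (div_pos (hqx i) (hp' i))]
          field_simp [(hqx i).ne', (hp' i).ne']
        calc Real.exp (-(E' * N)) * ∏ i, q (x i)
            ≤ Real.exp (∑ i, -g (x i)) * (Real.exp (-(E' * N)) * ∏ i, q (x i)) := by
              refine le_mul_of_one_le_left (mul_nonneg (Real.exp_pos _).le
                (prod_nonneg_of_nonneg hq.1 x)) (Real.one_le_exp ?_)
              rw [Finset.sum_neg_distrib]; linarith [not_le.1 hx.2]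
          _ = ∏ i, p (x i) := by
              rw [Finset.prod_congr rfl fun i _ => e i, Finset.prod_mul_distrib,
                Finset.prod_mul_distrib, ← Real.exp_sum, Finset.prod_const, Finset.card_univ,
                Fintype.card_fin, ← Real.exp_nat_mul]
              congr 3
              ring
      · push Not at hqx
        obtain ⟨i, hi⟩ := hqx
        rw [Finset.prod_eq_zero (Finset.mem_univ i) (le_antisymm hi (hq.1 _)), mul_zero]
        exact hpx
    · rw [if_neg hx, mul_zero]
      split_ifs <;> simp [hpx]
  refine le_trans ?_ hcm
  have e4 : Real.exp (-(E * N)) = Real.exp (-(E' * N)) * Real.exp (-((E - E') * N)) := by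
    rw [← Real.exp_add]; congr 1; ring
  rw [e4]
  exact mul_le_mul_of_nonneg_left (h2.le.trans hhalf) (Real.exp_pos _).le

/-- The upper half of Sanov's theorem, by counting types. -/
theorem seqProb_le_of_le_relEntropy {p : Ω → ℝ} (hp : p ∈ stdSimplex ℝ Ω) {N : ℕ}
    {A : (Fin N → Ω) → Prop} {E : ℝ}
    (h : ∀ x, A x → (∀ i, 0 < p (x i)) → E ≤ relEntropy (freq x) p) :
    seqProb p N A ≤ (N + 1) ^ Fintype.card Ω * Real.exp (-(E * N)) := by
  classical
  -- The `p`-probability of a sequence is `exp (-N D(freq x ‖ p))` times its probability under its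
  -- own empirical distribution.
  have hpt : ∀ x : Fin N → Ω, A x → ∏ i, p (x i) ≤ Real.exp (-(E * N)) * ∏ i, freq x (x i) := by
    intro x hx
    by_cases hpx : ∀ i, 0 < p (x i)
    · have hE := h x hx hpx
      have e : ∀ i, p (x i) = Real.exp (-Real.log (freq x (x i) / p (x i))) * freq x (x i) := by
        intro i
        have := freq_apply_pos x i
        rw [Real.exp_neg, Real.exp_log (div_pos this (hpx i))]
        field_simp [this.ne', (hpx i).ne']
      rw [Finset.prod_congr rfl fun i _ => e i, Finset.prod_mul_distrib, ← Real.exp_sum,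
        Finset.sum_neg_distrib, sum_apply_eq_freq x (fun a => Real.log (freq x a / p a))]
      refine mul_le_mul_of_nonneg_right (Real.exp_le_exp.2 ?_)
        (Finset.prod_nonneg fun i _ => (freq_apply_pos x i).le)
      have := mul_le_mul_of_nonneg_right hE (Nat.cast_nonneg (α := ℝ) N)
      unfold relEntropy at this
      linarith
    · push Not at hpx
      obtain ⟨i, hi⟩ := hpx
      rw [Finset.prod_eq_zero (Finset.mem_univ i) (le_antisymm hi (hp.1 _))]
      exact mul_nonneg (Real.exp_pos _).le (Finset.prod_nonneg fun i _ => (freq_apply_pos x i).le)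
  have hfreq : ∀ x : Fin N → Ω, 0 ≤ ∏ i, freq x (x i) := fun x =>
    Finset.prod_nonneg fun i _ => (freq_apply_pos x i).le
  let cnt : (Fin N → Ω) → (Ω → Fin (N + 1)) := fun x a =>
    ⟨Finset.card {i | x i = a}, Nat.lt_succ_of_le (by
      simpa using Finset.card_le_univ (α := Fin N) {i | x i = a})⟩
  -- On one type class `freq x` is a fixed distribution, so the sum is a probability. For `N = 0` it
  -- is the zero function, hence the separate case.
  have hfib : ∀ n : Ω → Fin (N + 1), ∑ x with cnt x = n, ∏ i, freq x (x i) ≤ 1 := by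
    intro n
    by_cases hn : ∃ y, cnt y = n
    · obtain ⟨y, rfl⟩ := hn
      have : ∀ x, cnt x = cnt y → freq x = freq y := by
        intro x hx
        ext a
        have := congrArg Fin.val (congrFun hx a)
        simp only [cnt] at this
        unfold freq
        convert congrArg (fun m : ℕ => (m : ℝ) / N) this
      rcases Nat.eq_zero_or_pos N with rfl | hN
      · refine (Finset.sum_le_sum_of_subset_of_nonneg (Finset.filter_subset _ _)
          fun x _ _ => hfreq x).trans ?_
        simp
      calc ∑ x with cnt x = cnt y, ∏ i, freq x (x i)
          = seqProb (freq y) N (fun x => cnt x = cnt y) := by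
            unfold seqProb
            rw [Finset.sum_filter, Finset.sum_filter]
            refine Finset.sum_congr rfl fun x _ => ?_
            by_cases hx : cnt x = cnt y
            · rw [if_pos hx, if_pos hx, this x hx]
            · rw [if_neg hx, if_neg hx]
        _ ≤ 1 := seqProb_le_one (freq_mem_stdSimplex hN y) N _
    · push Not at hn
      rw [Finset.filter_false_of_mem (fun x _ => hn x)]
      simp
  calc seqProb p N A ≤ ∑ x : Fin N → Ω, Real.exp (-(E * N)) * ∏ i, freq x (x i) := by
        unfold seqProb
        refine (Finset.sum_le_sum fun x hx => hpt x (Finset.mem_filter.1 hx).2).trans ?_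
        exact Finset.sum_le_sum_of_subset_of_nonneg (Finset.filter_subset _ _)
          fun x _ _ => mul_nonneg (Real.exp_pos _).le (hfreq x)
    _ = Real.exp (-(E * N)) * ∑ n, ∑ x with cnt x = n, ∏ i, freq x (x i) := by
        rw [← Finset.mul_sum, Finset.sum_fiberwise]
    _ ≤ Real.exp (-(E * N)) * ∑ n : Ω → Fin (N + 1), 1 := by
        gcongr with n
        exact hfib n
    _ = _ := by simp [mul_comm]

end Sequences

/-! ### The Rayleigh quotient of two quadratic forms -/

section Matrices

open Matrix
open scoped MatrixOrder

variable {k : ℕ}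

theorem matrixSqrt_mul_self {H : Matrix (Fin k) (Fin k) ℝ} (hH : H.PosSemidef) :
    matrixSqrt H * matrixSqrt H = H := by
  have hsa : IsSelfAdjoint H := hH.1
  have hcont : ContinuousOn Real.sqrt (spectrum ℝ H) := Real.continuous_sqrt.continuousOn
  have hnonneg : 0 ≤ H := hH.nonneg
  unfold matrixSqrt
  rw [← cfc_mul Real.sqrt Real.sqrt H]
  have : Set.EqOn (fun x => Real.sqrt x * Real.sqrt x) id (spectrum ℝ H) := fun x hx =>
    Real.mul_self_sqrt (spectrum_nonneg_of_nonneg hnonneg hx)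
  rw [cfc_congr this, cfc_id ℝ H]

theorem transpose_matrixSqrt (H : Matrix (Fin k) (Fin k) ℝ) :
    (matrixSqrt H)ᵀ = matrixSqrt H := by
  have : IsSelfAdjoint (matrixSqrt H) := cfc_predicate _ _
  simpa [IsSelfAdjoint, star_eq_conjTranspose] using this

theorem transpose_pseudoInverse (F : Matrix (Fin k) (Fin k) ℝ) :
    (pseudoInverse F)ᵀ = pseudoInverse F := by
  have : IsSelfAdjoint (pseudoInverse F) := cfc_predicate _ _
  simpa [IsSelfAdjoint, star_eq_conjTranspose] using this

theorem continuousOn_spectrum (F : Matrix (Fin k) (Fin k) ℝ) (f : ℝ → ℝ) :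
    ContinuousOn f (spectrum ℝ F) :=
  (Matrix.finite_real_spectrum (A := F)).continuousOn f

/-- On the spectrum this is `r⁻¹ * r * r⁻¹ = r⁻¹`, true also at `r = 0` because `0⁻¹ = 0`. It is the
only property of the inverse needed when `F` may be singular. -/
theorem pseudoInverse_mul_mul {F : Matrix (Fin k) (Fin k) ℝ} (hF : F.PosSemidef) :
    pseudoInverse F * F * pseudoInverse F = pseudoInverse F := by
  have hsa : IsSelfAdjoint F := hF.1
  have hc := continuousOn_spectrum F
  unfold pseudoInverse
  nth_rewrite 2 [← cfc_id ℝ F]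
  rw [← cfc_mul _ _ F (hc _) (hc _), ← cfc_mul _ _ F (hc _) (hc _)]
  refine cfc_congr fun x _ => ?_
  by_cases hx : x = 0 <;> simp [hx]

theorem pseudoInverse_mul_self {F : Matrix (Fin k) (Fin k) ℝ} (hF : F.PosSemidef)
    (hu : IsUnit F) : pseudoInverse F * F = 1 := by
  have hsa : IsSelfAdjoint F := hF.1
  have hc := continuousOn_spectrum F
  unfold pseudoInverse
  nth_rewrite 2 [← cfc_id ℝ F]
  rw [← cfc_mul _ _ F (hc _) (hc _), ← cfc_one ℝ F]
  refine cfc_congr fun x hx => ?_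
  have : x ≠ 0 := fun h => spectrum.zero_notMem ℝ hu (h ▸ hx)
  simp [this]

/-- The matrix `√H F⁻¹ √H`. -/
noncomputable def sandwich (H F : Matrix (Fin k) (Fin k) ℝ) : Matrix (Fin k) (Fin k) ℝ :=
  matrixSqrt H * pseudoInverse F * matrixSqrt H

theorem isHermitian_sandwich (H F : Matrix (Fin k) (Fin k) ℝ) : (sandwich H F).IsHermitian := by
  unfold sandwich
  rw [IsHermitian, conjTranspose_eq_transpose_of_trivial, transpose_mul, transpose_mul,
    transpose_matrixSqrt, transpose_pseudoInverse, Matrix.mul_assoc]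

theorem dotProduct_mulVec_le_maxEigenvalue {M : Matrix (Fin k) (Fin k) ℝ} (hM : M.IsHermitian)
    (u : Fin k → ℝ) : u ⬝ᵥ M *ᵥ u ≤ maxEigenvalue M * (u ⬝ᵥ u) := by
  have hsa : IsSelfAdjoint M := hM
  have hle : M ≤ algebraMap ℝ _ (maxEigenvalue M) :=
    (le_algebraMap_iff_spectrum_le hsa).2 fun x hx =>
      le_csSup (Matrix.finite_real_spectrum (A := M)).bddAbove hx
  have := (Matrix.posSemidef_iff_dotProduct_mulVec.1 (Matrix.le_iff.1 hle)).2 u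
  rw [sub_mulVec, dotProduct_sub, Algebra.algebraMap_eq_smul_one, smul_mulVec, one_mulVec,
    dotProduct_smul] at this
  simp only [star_trivial, smul_eq_mul] at this
  linarith

theorem exists_eigenvector_of_maxEigenvalue_pos {M : Matrix (Fin k) (Fin k) ℝ}
    (hpos : 0 < maxEigenvalue M) : ∃ u : Fin k → ℝ, u ≠ 0 ∧ M *ᵥ u = maxEigenvalue M • u := by
  have hne : (spectrum ℝ M).Nonempty := by
    by_contra h
    rw [maxEigenvalue, Set.not_nonempty_iff_eq_empty.1 h, Real.sSup_empty] at hpos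
    exact hpos.false
  have hmem : maxEigenvalue M ∈ spectrum ℝ M := hne.csSup_mem Matrix.finite_real_spectrum
  rw [← Matrix.spectrum_toLin', ← Module.End.hasEigenvalue_iff_mem_spectrum] at hmem
  obtain ⟨u, hu⟩ := hmem.exists_hasEigenvector
  exact ⟨u, hu.2, by simpa using hu.apply_eq_smul⟩

theorem mulVec_dotProduct_of_symm {A : Matrix (Fin k) (Fin k) ℝ} (hA : Aᵀ = A)
    (u v : Fin k → ℝ) : (A *ᵥ u) ⬝ᵥ v = u ⬝ᵥ A *ᵥ v := by
  rw [dotProduct_mulVec, ← mulVec_transpose, hA]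

/-- The Rayleigh quotient of `H` with respect to `F` attains the maximal eigenvalue of
`√H F⁻¹ √H`. -/
theorem exists_quadForm_eq {H F : Matrix (Fin k) (Fin k) ℝ} (hH : H.PosSemidef)
    (hF : F.PosSemidef) (hpos : 0 < maxEigenvalue (sandwich H F)) :
    ∃ v : Fin k → ℝ, 0 < v ⬝ᵥ H *ᵥ v ∧
      v ⬝ᵥ H *ᵥ v = maxEigenvalue (sandwich H F) * (v ⬝ᵥ F *ᵥ v) := by
  obtain ⟨u, hu0, hu⟩ := exists_eigenvector_of_maxEigenvalue_pos hpos
  set σ := maxEigenvalue (sandwich H F) with hσ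
  set S := matrixSqrt H with hS
  set G := pseudoInverse F with hG
  have hST : Sᵀ = S := transpose_matrixSqrt H
  have hGT : Gᵀ = G := transpose_pseudoInverse F
  have hM : S *ᵥ (G *ᵥ (S *ᵥ u)) = σ • u := by
    rw [mulVec_mulVec, mulVec_mulVec]; exact hu
  have huu : 0 < u ⬝ᵥ u := lt_of_le_of_ne
    (Finset.sum_nonneg fun i _ => mul_self_nonneg _) fun h => hu0 (dotProduct_self_eq_zero.1 h.symm)
  -- With `S = √H` and `G` the inverse of `F`, the eigenvector equation reads `S v = σ u`; both
  -- forms at `v` are then multiples of `u ⬝ᵥ u`.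
  set v := G *ᵥ (S *ᵥ u) with hv
  have h1 : v ⬝ᵥ H *ᵥ v = σ ^ 2 * (u ⬝ᵥ u) := by
    rw [← matrixSqrt_mul_self hH, ← hS, ← mulVec_mulVec, ← mulVec_dotProduct_of_symm hST, hM]
    simp [pow_two, mul_assoc]
  have h2 : v ⬝ᵥ F *ᵥ v = σ * (u ⬝ᵥ u) := by
    have : G *ᵥ (F *ᵥ v) = v := by
      rw [hv, mulVec_mulVec, mulVec_mulVec, hG, pseudoInverse_mul_mul hF]
    nth_rewrite 1 [hv]
    rw [mulVec_dotProduct_of_symm hGT, this, mulVec_dotProduct_of_symm hST, hM]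
    simp
  refine ⟨v, ?_, ?_⟩
  · rw [h1]; positivity
  · rw [h1, h2]; ring

/-- Expand the nonnegative form of `F` at `v - τ w`, where `w = F⁻¹ H v`. Both cross terms equal the
form of `H` at `v`, and the `w` term is the form of `√H F⁻¹ √H` at `√H v`. The free `τ` allows use
before `σ` is known to be positive. -/
theorem sq_le_of_quadForm {H F : Matrix (Fin k) (Fin k) ℝ} (hH : H.PosSemidef)
    (hF : F.PosSemidef) (hu : IsUnit F) (v : Fin k → ℝ) (τ : ℝ) :
    2 * τ * (v ⬝ᵥ H *ᵥ v) ≤ v ⬝ᵥ F *ᵥ v +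
      τ ^ 2 * (maxEigenvalue (sandwich H F) * (v ⬝ᵥ H *ᵥ v)) := by
  set σ := maxEigenvalue (sandwich H F) with hσ
  set S := matrixSqrt H with hS
  set G := pseudoInverse F with hG
  have hST : Sᵀ = S := transpose_matrixSqrt H
  have hGT : Gᵀ = G := transpose_pseudoInverse F
  have hFT : Fᵀ = F := by simpa using hF.1.eq
  have hGF : G * F = 1 := pseudoInverse_mul_self hF hu
  have hFG : F * G = 1 := mul_eq_one_comm.1 hGF
  set u := S *ᵥ v with hudef
  have huu : u ⬝ᵥ u = v ⬝ᵥ H *ᵥ v := by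
    rw [hudef, mulVec_dotProduct_of_symm hST, mulVec_mulVec, hS, matrixSqrt_mul_self hH]
  set w := G *ᵥ (S *ᵥ u) with hw
  have hFw : F *ᵥ w = S *ᵥ u := by rw [hw, mulVec_mulVec, hFG, one_mulVec]
  have h0 := (posSemidef_iff_dotProduct_mulVec.1 hF).2 (v - τ • w)
  simp only [star_trivial] at h0
  have e1 : w ⬝ᵥ F *ᵥ v = u ⬝ᵥ u := by
    rw [← mulVec_dotProduct_of_symm hFT, hFw, mulVec_dotProduct_of_symm hST, ← hudef]
  have e2 : v ⬝ᵥ F *ᵥ w = u ⬝ᵥ u := by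
    rw [hFw, ← mulVec_dotProduct_of_symm hST, ← hudef]
  have e3 : w ⬝ᵥ F *ᵥ w ≤ σ * (u ⬝ᵥ u) := by
    rw [hFw, ← mulVec_dotProduct_of_symm hST, dotProduct_comm]
    have := dotProduct_mulVec_le_maxEigenvalue (isHermitian_sandwich H F) u
    rw [← hσ] at this
    have e : sandwich H F *ᵥ u = S *ᵥ w := by
      unfold sandwich
      rw [hw, ← mulVec_mulVec, ← mulVec_mulVec]
    rwa [e] at this
  rw [mulVec_sub, mulVec_smul, sub_dotProduct, dotProduct_sub, dotProduct_sub, smul_dotProduct,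
    smul_dotProduct, dotProduct_smul, dotProduct_smul, e1, e2] at h0
  simp only [smul_eq_mul] at h0
  rw [← huu]
  nlinarith [mul_le_mul_of_nonneg_left e3 (sq_nonneg τ)]

/-- If `σ ≤ 0`, the `τ²` term of `sq_le_of_quadForm` can be dropped, and a large `τ` forces the form
of `H`, hence `√H` and `H`, to vanish. -/
theorem maxEigenvalue_sandwich_pos {H F : Matrix (Fin k) (Fin k) ℝ} (hH : H.PosSemidef)
    (hF : F.PosSemidef) (hu : IsUnit F) (hne : H ≠ 0) : 0 < maxEigenvalue (sandwich H F) := by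
  by_contra hcon
  push Not at hcon
  apply hne
  have hzero : ∀ v : Fin k → ℝ, v ⬝ᵥ H *ᵥ v = 0 := by
    intro v
    have hnn : 0 ≤ v ⬝ᵥ H *ᵥ v := by simpa using (posSemidef_iff_dotProduct_mulVec.1 hH).2 v
    by_contra hv
    have hpos := lt_of_le_of_ne hnn (Ne.symm hv)
    have h1 := sq_le_of_quadForm hH hF hu v ((v ⬝ᵥ F *ᵥ v + 1) / (v ⬝ᵥ H *ᵥ v))
    have h2 : ((v ⬝ᵥ F *ᵥ v + 1) / (v ⬝ᵥ H *ᵥ v)) ^ 2 *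
        (maxEigenvalue (sandwich H F) * (v ⬝ᵥ H *ᵥ v)) ≤ 0 :=
      mul_nonpos_of_nonneg_of_nonpos (sq_nonneg _)
        (mul_nonpos_of_nonpos_of_nonneg hcon hnn)
    have h3 : 0 ≤ v ⬝ᵥ F *ᵥ v := by simpa using (posSemidef_iff_dotProduct_mulVec.1 hF).2 v
    have h4 : 2 * ((v ⬝ᵥ F *ᵥ v + 1) / (v ⬝ᵥ H *ᵥ v)) * (v ⬝ᵥ H *ᵥ v)
        = 2 * (v ⬝ᵥ F *ᵥ v + 1) := by field_simp
    linarith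
  have hS : matrixSqrt H = 0 := by
    have : ∀ v : Fin k → ℝ, matrixSqrt H *ᵥ v = 0 := by
      intro v
      rw [← dotProduct_self_eq_zero, mulVec_dotProduct_of_symm (transpose_matrixSqrt H),
        mulVec_mulVec, matrixSqrt_mul_self hH, hzero]
    ext i j
    simpa using congrFun (this (Pi.single j 1)) i
  rw [← matrixSqrt_mul_self hH, hS, mul_zero]

theorem quadForm_le_maxEigenvalue_mul {H F : Matrix (Fin k) (Fin k) ℝ} (hH : H.PosSemidef)
    (hF : F.PosSemidef) (hu : IsUnit F) (hne : H ≠ 0) (v : Fin k → ℝ) :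
    v ⬝ᵥ H *ᵥ v ≤ maxEigenvalue (sandwich H F) * (v ⬝ᵥ F *ᵥ v) := by
  have hpos := maxEigenvalue_sandwich_pos hH hF hu hne
  have h := sq_le_of_quadForm hH hF hu v (1 / maxEigenvalue (sandwich H F))
  set σ := maxEigenvalue (sandwich H F)
  set y := v ⬝ᵥ H *ᵥ v
  have e : (1 / σ) ^ 2 * (σ * y) = y / σ := by field_simp
  have e2 : 2 * (1 / σ) * y = 2 * (y / σ) := by field_simp
  rw [e, e2] at h
  have : y / σ ≤ v ⬝ᵥ F *ᵥ v := by linarith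
  rwa [div_le_iff₀' hpos] at this

/-- A nonsingular positive semidefinite matrix is bounded below by a multiple of the identity. -/
theorem exists_pos_mul_le_quadForm {F : Matrix (Fin k) (Fin k) ℝ} (hF : F.PosSemidef)
    (hu : IsUnit F) : ∃ m > 0, ∀ v : Fin k → ℝ, m * (v ⬝ᵥ v) ≤ v ⬝ᵥ F *ᵥ v := by
  -- In dimension zero the identity matrix is `0`, so the comparison with `H = 1` is unavailable
  -- there.
  rcases isEmpty_or_nonempty (Fin k) with hk | hk
  · exact ⟨1, one_pos, fun v => by simp [dotProduct]⟩
  have h1 : (1 : Matrix (Fin k) (Fin k) ℝ) ≠ 0 := one_ne_zero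
  exact ⟨_, inv_pos.2 (maxEigenvalue_sandwich_pos PosSemidef.one hF hu h1), fun v => by
    have := quadForm_le_maxEigenvalue_mul PosSemidef.one hF hu h1 v
    rw [one_mulVec] at this
    rwa [inv_mul_le_iff₀ (maxEigenvalue_sandwich_pos PosSemidef.one hF hu h1)]⟩

end Matrices

/-! ### Second-order expansions and concavity -/

section Calculus

variable {E : Type*} [NormedAddCommGroup E] [NormedSpace ℝ E]

theorem hasFDerivAt_fderiv_of_contDiffAt {f : E → ℝ} {θ : E} (hf : ContDiffAt ℝ 2 f θ) :
    HasFDerivAt (fderiv ℝ f) (fderiv ℝ (fderiv ℝ f) θ) θ :=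
  ((hf.fderiv_right (m := 1) (by norm_num)).differentiableAt one_ne_zero).hasFDerivAt

theorem tendsto_norm_fderiv_sub {G : Type*} [NormedAddCommGroup G] [NormedSpace ℝ G] {g : E → G}
    {θ : E} (hg : ContDiffAt ℝ 1 g θ) :
    Tendsto (fun t => ‖fderiv ℝ g t - fderiv ℝ g θ‖) (𝓝 θ) (𝓝 0) :=
  tendsto_iff_norm_sub_tendsto_zero.1 (hg.fderiv_right (m := 0) (by norm_num)).continuousAt

theorem tendsto_norm_fderiv_fderiv_sub {f : E → ℝ} {θ : E} (hf : ContDiffAt ℝ 2 f θ) :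
    Tendsto (fun t => ‖fderiv ℝ (fderiv ℝ f) t - fderiv ℝ (fderiv ℝ f) θ‖) (𝓝 θ) (𝓝 0) :=
  tendsto_norm_fderiv_sub (hf.fderiv_right (m := 1) (by norm_num))

/-- The second order Taylor expansion at a critical point. -/
theorem eventually_abs_sub_half_fderiv_le {f : E → ℝ} {θ : E} (hf : ContDiffAt ℝ 2 f θ)
    (hcrit : fderiv ℝ f θ = 0) {η : ℝ} (hη : 0 < η) :
    ∀ᶠ s in 𝓝 θ, |f s - f θ - fderiv ℝ (fderiv ℝ f) θ (s - θ) (s - θ) / 2| ≤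
      η * ‖s - θ‖ ^ 2 := by
  have h1 := (hasFDerivAt_fderiv_of_contDiffAt hf).isLittleO.def hη
  have h2 : ∀ᶠ s in 𝓝 θ, DifferentiableAt ℝ f s :=
    (hf.eventually (by simp)).mono fun s hs => hs.differentiableAt two_ne_zero
  obtain ⟨r, hr, hball⟩ := Metric.eventually_nhds_iff_ball.1 (h1.and h2)
  filter_upwards [Metric.ball_mem_nhds θ hr] with s hs
  set v := s - θ with hv
  set B := fderiv ℝ (fderiv ℝ f) θ with hB
  have hmem : ∀ τ ∈ Set.Icc (0 : ℝ) 1, θ + τ • v ∈ Metric.ball θ r := by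
    intro τ hτ
    rw [mem_ball_iff_norm] at hs ⊢
    rw [add_sub_cancel_left, norm_smul, Real.norm_of_nonneg hτ.1]
    exact (mul_le_of_le_one_left (norm_nonneg _) hτ.2).trans_lt hs
  -- Along the segment, subtracting the quadratic model leaves a derivative controlled by the
  -- first-order expansion of `fderiv ℝ f`; the mean value inequality finishes.
  have hd : ∀ τ ∈ Set.Icc (0 : ℝ) 1, HasDerivWithinAt
      (fun τ : ℝ => f (θ + τ • v) - τ ^ 2 * (B v v / 2))
      (fderiv ℝ f (θ + τ • v) v - τ * B v v) (Set.Icc 0 1) τ := by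
    intro τ hτ
    have hline : HasDerivAt (fun τ : ℝ => θ + τ • v) v τ := by
      simpa using ((hasDerivAt_id τ).smul_const v).const_add θ
    have := ((hball _ (hmem τ hτ)).2.hasFDerivAt.comp_hasDerivAt τ hline).sub
      ((hasDerivAt_pow 2 τ).mul_const (B v v / 2))
    refine (this.congr_deriv ?_).hasDerivWithinAt
    simp; ring
  have hb : ∀ τ ∈ Set.Ico (0 : ℝ) 1, ‖fderiv ℝ f (θ + τ • v) v - τ * B v v‖ ≤ η * ‖v‖ ^ 2 := by
    intro τ hτ
    have hτ' : τ ∈ Set.Icc (0 : ℝ) 1 := ⟨hτ.1, hτ.2.le⟩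
    have h3 := (hball _ (hmem τ hτ')).1
    rw [hcrit, sub_zero, add_sub_cancel_left, map_smul, norm_smul, Real.norm_of_nonneg hτ.1] at h3
    have h4 := (fderiv ℝ f (θ + τ • v) - τ • B v).le_of_opNorm_le h3 v
    have h5 : (fderiv ℝ f (θ + τ • v) - τ • B v) v = fderiv ℝ f (θ + τ • v) v - τ * B v v := by
      simp
    rw [h5] at h4
    refine h4.trans ?_
    have : η * (τ * ‖v‖) * ‖v‖ = τ * (η * ‖v‖ ^ 2) := by ring
    rw [this]
    exact mul_le_of_le_one_left (by positivity) hτ.2.le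
  have := norm_image_sub_le_of_norm_deriv_le_segment_01' hd hb
  rw [Real.norm_eq_abs] at this
  convert this using 2
  simp [hv]
  ring

theorem tendsto_add_smul (θ v : E) : Tendsto (fun ε : ℝ => θ + ε • v) (𝓝[>] 0) (𝓝 θ) := by
  have : Continuous fun ε : ℝ => θ + ε • v := by fun_prop
  simpa using (this.tendsto 0).mono_left nhdsWithin_le_nhds

theorem tendsto_div_sq_along_ray {f : E → ℝ} {θ : E} (hf : ContDiffAt ℝ 2 f θ)
    (hcrit : fderiv ℝ f θ = 0) (h0 : f θ = 0) (v : E) :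
    Tendsto (fun ε : ℝ => f (θ + ε • v) / ε ^ 2) (𝓝[>] 0)
      (𝓝 (fderiv ℝ (fderiv ℝ f) θ v v / 2)) := by
  rw [Metric.tendsto_nhds]
  intro δ hδ
  have hη : 0 < δ / (2 * (‖v‖ ^ 2 + 1)) := by positivity
  have hray := tendsto_add_smul θ v
  filter_upwards [hray.eventually (eventually_abs_sub_half_fderiv_le hf hcrit hη),
    self_mem_nhdsWithin] with ε h1 hε
  have hε : 0 < ε := hε
  rw [add_sub_cancel_left, h0, norm_smul, Real.norm_of_nonneg hε.le] at h1
  simp only [map_smul, _root_.smul_apply, smul_eq_mul] at h1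
  rw [Real.dist_eq]
  set b := fderiv ℝ (fderiv ℝ f) θ v v
  have e : f (θ + ε • v) / ε ^ 2 - b / 2 =
      (f (θ + ε • v) - 0 - ε * (ε * b) / 2) / ε ^ 2 := by field_simp; ring
  rw [e, abs_div, abs_of_pos (show 0 < ε ^ 2 by positivity), div_lt_iff₀ (by positivity)]
  refine h1.trans_lt ?_
  rw [div_mul_eq_mul_div, div_lt_iff₀ (by positivity)]
  have : 0 < δ * ε ^ 2 := by positivity
  nlinarith [mul_nonneg this.le (sq_nonneg ‖v‖)]

/-- Strong concavity gives quadratic growth away from a critical point. -/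
theorem apply_le_sub_half_of_fderiv_fderiv_le {f : E → ℝ} {U : Set E} (hU : Convex ℝ U)
    (hf : ∀ t ∈ U, ContDiffAt ℝ 2 f t) {s t : E} (hs : s ∈ U) (ht : t ∈ U)
    (hcrit : fderiv ℝ f s = 0) {K : ℝ}
    (hK : ∀ u ∈ U, fderiv ℝ (fderiv ℝ f) u (t - s) (t - s) ≤ -K) :
    f t ≤ f s - K / 2 := by
  set v := t - s with hv
  have hmem : ∀ τ ∈ Set.Icc (0 : ℝ) 1, s + τ • v ∈ U := fun τ hτ =>
    hU.add_smul_sub_mem hs ht hτ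
  have hline : ∀ τ : ℝ, HasDerivAt (fun τ : ℝ => s + τ • v) v τ := fun τ => by
    simpa using ((hasDerivAt_id τ).smul_const v).const_add s
  have hd1 : ∀ τ ∈ Set.Icc (0 : ℝ) 1, HasDerivAt
      (fun τ : ℝ => f (s + τ • v) + τ ^ 2 * (K / 2))
      (fderiv ℝ f (s + τ • v) v + τ * K) τ := by
    intro τ hτ
    have := (((hf _ (hmem τ hτ)).differentiableAt two_ne_zero).hasFDerivAt.comp_hasDerivAt τ
      (hline τ)).add ((hasDerivAt_pow 2 τ).mul_const (K / 2))
    refine this.congr_deriv ?_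
    simp; ring
  have hd2 : ∀ τ ∈ Set.Icc (0 : ℝ) 1, HasDerivAt
      (fun τ : ℝ => fderiv ℝ f (s + τ • v) v + τ * K)
      (fderiv ℝ (fderiv ℝ f) (s + τ • v) v v + K) τ := by
    intro τ hτ
    have h1 := (hasFDerivAt_fderiv_of_contDiffAt (hf _ (hmem τ hτ))).comp_hasDerivAt τ (hline τ)
    have := (h1.clm_apply (hasDerivAt_const τ v)).add ((hasDerivAt_id τ).mul_const K)
    refine this.congr_deriv ?_
    simp
  -- This derivative is antitone and vanishes at `τ = 0`, so it is nonpositive and `f (s + τ v) + τ²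
  -- K / 2` is antitone too.
  have hanti2 : AntitoneOn (fun τ : ℝ => fderiv ℝ f (s + τ • v) v + τ * K) (Set.Icc 0 1) := by
    refine antitoneOn_of_deriv_nonpos (convex_Icc 0 1)
      (fun τ hτ => (hd2 τ hτ).continuousAt.continuousWithinAt)
      (fun τ hτ => (hd2 τ (interior_subset hτ)).differentiableAt.differentiableWithinAt)
      fun τ hτ => ?_
    rw [(hd2 τ (interior_subset hτ)).deriv]
    linarith [hK _ (hmem τ (interior_subset hτ))]
  have hanti1 : AntitoneOn (fun τ : ℝ => f (s + τ • v) + τ ^ 2 * (K / 2)) (Set.Icc 0 1) := by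
    refine antitoneOn_of_deriv_nonpos (convex_Icc 0 1)
      (fun τ hτ => (hd1 τ hτ).continuousAt.continuousWithinAt)
      (fun τ hτ => (hd1 τ (interior_subset hτ)).differentiableAt.differentiableWithinAt)
      fun τ hτ => ?_
    have hτ' := interior_subset hτ
    rw [(hd1 τ hτ').deriv]
    have := hanti2 (Set.left_mem_Icc.2 zero_le_one) hτ' hτ'.1
    simpa [hcrit] using this
  have := hanti1 (Set.left_mem_Icc.2 zero_le_one) (Set.right_mem_Icc.2 zero_le_one) zero_le_one
  simp [hv] at this
  linarith

end Calculus

/-- Joint continuity in the weights and the point, uniform over directions through operator norms.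
With `g x` the second derivative of `log p · x`, it keeps the Hessian of the log-likelihood close to
minus the Fisher form. -/
theorem exists_abs_sum_mul_apply_sub_le {E Ω : Type*} [NormedAddCommGroup E] [NormedSpace ℝ E]
    [Fintype Ω] {g : Ω → E → (E →L[ℝ] E →L[ℝ] ℝ)} {q₀ : Ω → ℝ} {θ : E}
    (hg : ∀ x, Tendsto (fun t => ‖g x t - g x θ‖) (𝓝 θ) (𝓝 0)) {ε : ℝ} (hε : 0 < ε) :
    ∃ δ > 0, ∀ q : Ω → ℝ, (∀ x, |q x - q₀ x| < δ) → ∀ t ∈ Metric.ball θ δ, ∀ v,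
      |∑ x, q x * g x t v v - ∑ x, q₀ x * g x θ v v| ≤ ε * ‖v‖ ^ 2 := by
  have hlim : ∀ x, Tendsto
      (fun z : ℝ × E => |q₀ x + z.1| * ‖g x z.2 - g x θ‖ + |z.1| * ‖g x θ‖) (𝓝 (0, θ)) (𝓝 0) := by
    intro x
    have h1 : Tendsto (fun z : ℝ × E => |q₀ x + z.1|) (𝓝 (0, θ)) (𝓝 |q₀ x + 0|) :=
      (by fun_prop : Continuous fun z : ℝ × E => |q₀ x + z.1|).tendsto (0, θ)
    have h2 : Tendsto (fun z : ℝ × E => |z.1| * ‖g x θ‖) (𝓝 (0, θ)) (𝓝 (|0| * ‖g x θ‖)) :=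
      (by fun_prop : Continuous fun z : ℝ × E => |z.1| * ‖g x θ‖).tendsto (0, θ)
    have h3 : Tendsto (fun z : ℝ × E => ‖g x z.2 - g x θ‖) (𝓝 (0, θ)) (𝓝 0) :=
      (hg x).comp (continuous_snd.tendsto ((0 : ℝ), θ))
    simpa using (h1.mul h3).add h2
  have hev := eventually_all.2 fun x => (hlim x).eventually
    (gt_mem_nhds (show 0 < ε / (Fintype.card Ω + 1) by positivity))
  obtain ⟨δ, hδ, hball⟩ := Metric.eventually_nhds_iff_ball.1 hev
  refine ⟨δ, hδ, fun q hq t ht v => ?_⟩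
  rw [← Finset.sum_sub_distrib]
  have hx : ∀ x, |q x * g x t v v - q₀ x * g x θ v v| ≤
      ε / (Fintype.card Ω + 1) * ‖v‖ ^ 2 := by
    intro x
    have hmem : (q x - q₀ x, t) ∈ Metric.ball ((0 : ℝ), θ) δ := by
      rw [Metric.mem_ball, Prod.dist_eq, max_lt_iff]
      exact ⟨by simpa [Real.dist_eq] using hq x, ht⟩
    have h1 := hball _ hmem x
    simp only [add_sub_cancel] at h1
    have h2 : |(g x t - g x θ) v v| ≤ ‖g x t - g x θ‖ * ‖v‖ * ‖v‖ :=
      (g x t - g x θ).le_opNorm₂ v v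
    have h3 : |g x θ v v| ≤ ‖g x θ‖ * ‖v‖ * ‖v‖ := (g x θ).le_opNorm₂ v v
    have e : q x * g x t v v - q₀ x * g x θ v v =
        q x * (g x t - g x θ) v v + (q x - q₀ x) * g x θ v v := by
      rw [_root_.sub_apply, _root_.sub_apply]; ring
    calc _ ≤ |q x| * |(g x t - g x θ) v v| + |q x - q₀ x| * |g x θ v v| := by
          rw [e, ← abs_mul, ← abs_mul]; exact abs_add_le _ _
      _ ≤ |q x| * (‖g x t - g x θ‖ * ‖v‖ * ‖v‖) + |q x - q₀ x| * (‖g x θ‖ * ‖v‖ * ‖v‖) := by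
          gcongr
      _ = (|q x| * ‖g x t - g x θ‖ + |q x - q₀ x| * ‖g x θ‖) * ‖v‖ ^ 2 := by ring
      _ ≤ _ := by gcongr
  refine (Finset.abs_sum_le_sum_abs _ _).trans ((Finset.sum_le_sum fun x _ => hx x).trans ?_)
  rw [Finset.sum_const, Finset.card_univ, nsmul_eq_mul, ← mul_assoc]
  refine mul_le_mul_of_nonneg_right ?_ (sq_nonneg _)
  rw [mul_div_assoc', div_le_iff₀ (by positivity)]
  linarith

/-! ### Log-likelihood, Fisher information and relative entropy -/

section LogLikelihood

variable {E : Type*} [NormedAddCommGroup E] [NormedSpace ℝ E] {Ω : Type*} [Fintype Ω]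

/-- A family of probability distributions that is twice continuously differentiable and has a
constant support near `θ`. -/
structure IsRegularAt (p : E → Ω → ℝ) (θ : E) : Prop where
  mem_stdSimplex : ∀ᶠ t in 𝓝 θ, p t ∈ stdSimplex ℝ Ω
  contDiffAt : ∀ x, ContDiffAt ℝ 2 (fun t => p t x) θ
  eventually_eq_zero : ∀ x, p θ x = 0 → ∀ᶠ t in 𝓝 θ, p t x = 0

/-- The normalized log-likelihood of the parameter `t` for the empirical distribution `q`. -/
noncomputable def logLik (p : E → Ω → ℝ) (q : Ω → ℝ) (t : E) : ℝ :=
  ∑ x, q x * Real.log (p t x)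

/-- The quadratic form of the Fisher matrix. -/
noncomputable def fisherForm (p : E → Ω → ℝ) (θ : E) (v : E) : ℝ :=
  ∑ x, p θ x * (fderiv ℝ (fun t => Real.log (p t x)) θ v) ^ 2

namespace IsRegularAt

variable {p : E → Ω → ℝ} {θ : E}

theorem mem_self (h : IsRegularAt p θ) : p θ ∈ stdSimplex ℝ Ω := h.mem_stdSimplex.self_of_nhds

theorem eventually_pos (h : IsRegularAt p θ) : ∀ᶠ t in 𝓝 θ, ∀ x, p θ x ≠ 0 → 0 < p t x := by
  rw [eventually_all]
  intro x
  by_cases hx : p θ x = 0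
  · simp [hx]
  · have : 0 < p θ x := lt_of_le_of_ne (h.mem_self.1 x) (Ne.symm hx)
    exact ((h.contDiffAt x).continuousAt.eventually (lt_mem_nhds this)).mono fun t ht _ => ht

theorem eventually_zero (h : IsRegularAt p θ) : ∀ᶠ t in 𝓝 θ, ∀ x, p θ x = 0 → p t x = 0 := by
  rw [eventually_all]
  intro x
  by_cases hx : p θ x = 0
  · exact (h.eventually_eq_zero x hx).mono fun t ht _ => ht
  · simp [hx]

/-- Near `θ` the support neither grows nor shrinks. Openness of regularity lets pointwise derivative
identities be differentiated again. -/
theorem eventually_isRegularAt (h : IsRegularAt p θ) : ∀ᶠ t in 𝓝 θ, IsRegularAt p t := by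
  have h1 : ∀ᶠ t in 𝓝 θ, ∀ x, ContDiffAt ℝ 2 (fun t => p t x) t :=
    eventually_all.2 fun x => (h.contDiffAt x).eventually (by simp)
  filter_upwards [h.mem_stdSimplex.eventually_nhds, h1, h.eventually_zero.eventually_nhds,
    h.eventually_pos] with t ht1 ht2 ht3 ht4
  refine ⟨ht1, ht2, fun x hx => ?_⟩
  have : p θ x = 0 := by
    by_contra hne
    exact (ht4 x hne).ne' hx
  exact ht3.mono fun u hu => hu x this

theorem contDiffAt_log (h : IsRegularAt p θ) (x : Ω) :
    ContDiffAt ℝ 2 (fun t => Real.log (p t x)) θ := by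
  by_cases hx : p θ x = 0
  · refine (contDiffAt_const (c := (0 : ℝ))).congr_of_eventuallyEq ?_
    exact (h.eventually_eq_zero x hx).mono fun t ht => by simp [ht]
  · exact (h.contDiffAt x).log hx

theorem contDiffAt_logLik (h : IsRegularAt p θ) (q : Ω → ℝ) :
    ContDiffAt ℝ 2 (logLik p q) θ := by
  unfold logLik
  exact ContDiffAt.sum fun x _ => contDiffAt_const.mul (h.contDiffAt_log x)

/-- Off the support both sides vanish, since `p · x` is locally zero; sums can therefore run over
all of `Ω`. -/
theorem fderiv_log (h : IsRegularAt p θ) (x : Ω) :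
    p θ x • fderiv ℝ (fun t => Real.log (p t x)) θ = fderiv ℝ (fun t => p t x) θ := by
  by_cases hx : p θ x = 0
  · have : (fun t => p t x) =ᶠ[𝓝 θ] fun _ => (0 : ℝ) := h.eventually_eq_zero x hx
    rw [this.fderiv_eq, hx]
    simp
  · rw [((h.contDiffAt x).differentiableAt two_ne_zero).hasFDerivAt.log hx |>.fderiv, smul_smul,
      mul_inv_cancel₀ hx, one_smul]

theorem fderiv_logLik (h : IsRegularAt p θ) (q : Ω → ℝ) :
    fderiv ℝ (logLik p q) θ = ∑ x, q x • fderiv ℝ (fun t => Real.log (p t x)) θ := by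
  unfold logLik
  refine (HasFDerivAt.fun_sum fun x _ => ?_).fderiv
  exact (((h.contDiffAt_log x).differentiableAt two_ne_zero).hasFDerivAt).const_mul (q x)

theorem fderiv_fderiv_logLik (h : IsRegularAt p θ) (q : Ω → ℝ) :
    fderiv ℝ (fderiv ℝ (logLik p q)) θ =
      ∑ x, q x • fderiv ℝ (fderiv ℝ (fun t => Real.log (p t x))) θ := by
  have : fderiv ℝ (logLik p q) =ᶠ[𝓝 θ]
      fun t => ∑ x, q x • fderiv ℝ (fun t => Real.log (p t x)) t :=
    h.eventually_isRegularAt.mono fun t ht => ht.fderiv_logLik q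
  rw [this.fderiv_eq]
  refine (HasFDerivAt.fun_sum fun x _ => ?_).fderiv
  exact (hasFDerivAt_fderiv_of_contDiffAt (h.contDiffAt_log x)).const_smul (q x)

theorem fderiv_fderiv_logLik_apply (h : IsRegularAt p θ) (q : Ω → ℝ) (v : E) :
    fderiv ℝ (fderiv ℝ (logLik p q)) θ v v =
      ∑ x, q x * fderiv ℝ (fderiv ℝ (fun t => Real.log (p t x))) θ v v := by
  rw [h.fderiv_fderiv_logLik]
  simp only [_root_.sum_apply, _root_.smul_apply, smul_eq_mul]

theorem sum_fderiv_eq_zero (h : IsRegularAt p θ) : ∑ x, fderiv ℝ (fun t => p t x) θ = 0 := by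
  have h1 : HasFDerivAt (fun t => ∑ x, p t x) (∑ x, fderiv ℝ (fun t => p t x) θ) θ :=
    HasFDerivAt.fun_sum fun x _ => ((h.contDiffAt x).differentiableAt two_ne_zero).hasFDerivAt
  have h2 : (fun t => ∑ x, p t x) =ᶠ[𝓝 θ] fun _ => (1 : ℝ) := h.mem_stdSimplex.mono fun t ht => ht.2
  rw [← h1.fderiv, h2.fderiv_eq]
  simp

theorem fderiv_apply_mul (h : IsRegularAt p θ) (v : E) :
    ∑ x, fderiv ℝ (fun t => p t x) θ v * fderiv ℝ (fun t => Real.log (p t x)) θ v =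
      fisherForm p θ v := by
  refine Finset.sum_congr rfl fun x _ => ?_
  rw [← h.fderiv_log x]
  simp only [_root_.smul_apply, smul_eq_mul]
  ring

/-- The expected second derivative of the log-likelihood is minus the Fisher information. -/
theorem fderiv_fderiv_logLik_self (h : IsRegularAt p θ) (v : E) :
    fderiv ℝ (fderiv ℝ (logLik p (p θ))) θ v v = -fisherForm p θ v := by
  -- The score has mean zero at every nearby parameter; differentiating this identity gives Fisher
  -- form plus expected Hessian equal to zero.
  have h0 : (fun t => ∑ x, p t x • fderiv ℝ (fun t => Real.log (p t x)) t) =ᶠ[𝓝 θ]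
      fun _ => (0 : E →L[ℝ] ℝ) := h.eventually_isRegularAt.mono fun t ht => by
    simp only [ht.fderiv_log]
    exact ht.sum_fderiv_eq_zero
  have h1 := HasFDerivAt.fun_sum (u := Finset.univ) fun x _ =>
    ((h.contDiffAt x).differentiableAt two_ne_zero).hasFDerivAt.fun_smul
      (hasFDerivAt_fderiv_of_contDiffAt (h.contDiffAt_log x))
  have h2 := h1.fderiv
  rw [h0.fderiv_eq] at h2
  have h3 := congrArg (fun B => B v v) h2
  simp only [fderiv_fun_const, Pi.zero_apply, _root_.zero_apply,
    _root_.sum_apply, _root_.add_apply, _root_.smul_apply,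
    ContinuousLinearMap.smulRight_apply, smul_eq_mul, Finset.sum_add_distrib] at h3
  rw [h.fderiv_apply_mul] at h3
  rw [h.fderiv_fderiv_logLik_apply]
  linarith

theorem relEntropy_eventuallyEq (h : IsRegularAt p θ) :
    (fun t => relEntropy (p t) (p θ)) =ᶠ[𝓝 θ]
      fun t => ∑ x, p t x * (Real.log (p t x) - Real.log (p θ x)) := by
  filter_upwards [h.eventually_pos, h.eventually_zero] with t h1 h2
  refine Finset.sum_congr rfl fun x _ => ?_
  by_cases hx : p θ x = 0
  · simp [h2 x hx]
  · rw [Real.log_div (h1 x hx).ne' hx]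

/-- The relative entropy of neighbouring distributions is half the Fisher information, to second
order. -/
theorem tendsto_relEntropy_div_sq (h : IsRegularAt p θ) (v : E) :
    Tendsto (fun ε : ℝ => relEntropy (p (θ + ε • v)) (p θ) / ε ^ 2) (𝓝[>] 0)
      (𝓝 (fisherForm p θ v / 2)) := by
  have heq := h.relEntropy_eventuallyEq
  have hcd : ContDiffAt ℝ 2 (fun t => relEntropy (p t) (p θ)) θ := by
    refine ContDiffAt.congr_of_eventuallyEq ?_ heq
    exact ContDiffAt.sum fun x _ => (h.contDiffAt x).mul ((h.contDiffAt_log x).sub contDiffAt_const)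
  -- The part from differentiating the logarithm is `∑ ∇p = 0`. The surviving coefficients vanish at
  -- `θ`, so the second derivative there only needs theirs.
  have hfd : fderiv ℝ (fun t => relEntropy (p t) (p θ)) =ᶠ[𝓝 θ]
      fun t => ∑ x, (Real.log (p t x) - Real.log (p θ x)) • fderiv ℝ (fun t => p t x) t := by
    filter_upwards [h.eventually_isRegularAt, heq.eventuallyEq_nhds] with t ht ht2
    rw [ht2.fderiv_eq]
    have h1 := HasFDerivAt.fun_sum (u := Finset.univ) fun x _ =>
      ((ht.contDiffAt x).differentiableAt two_ne_zero).hasFDerivAt.fun_mul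
        (((ht.contDiffAt_log x).differentiableAt two_ne_zero).hasFDerivAt.sub_const
          (Real.log (p θ x)))
    rw [h1.fderiv, Finset.sum_add_distrib]
    simp only [ht.fderiv_log, ht.sum_fderiv_eq_zero, zero_add]
  have hcrit : fderiv ℝ (fun t => relEntropy (p t) (p θ)) θ = 0 := by
    rw [hfd.self_of_nhds]; simp
  have h0 : relEntropy (p θ) (p θ) = 0 := by
    refine heq.self_of_nhds.trans ?_; simp
  have := tendsto_div_sq_along_ray hcd hcrit h0 v
  convert this using 3
  rw [hfd.fderiv_eq]
  have h1 := HasFDerivAt.fun_sum (u := Finset.univ) fun x _ =>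
    (((h.contDiffAt_log x).differentiableAt two_ne_zero).hasFDerivAt.sub_const
      (Real.log (p θ x))).fun_smul (hasFDerivAt_fderiv_of_contDiffAt (h.contDiffAt x))
  rw [h1.fderiv, ← h.fderiv_apply_mul]
  simp only [sub_self, zero_smul, zero_add, _root_.sum_apply,
    ContinuousLinearMap.smulRight_apply, _root_.smul_apply, smul_eq_mul]
  exact Finset.sum_congr rfl fun x _ => by ring

/-- Near `θ`, and for empirical distributions near `p θ`, the log-likelihood is strongly concave
in the Fisher metric. -/
theorem exists_ball_logLik_le (h : IsRegularAt p θ) {m : ℝ} (hm : 0 < m)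
    (hF : ∀ v, m * ‖v‖ ^ 2 ≤ fisherForm p θ v) {c : ℝ} (hc : c < 1) {W : Set E} (hW : W ∈ 𝓝 θ) :
    ∃ ρ > 0, Metric.ball θ ρ ⊆ W ∧ ∃ η > 0, ∀ q : Ω → ℝ, (∀ x, |q x - p θ x| < η) →
      ∀ s ∈ Metric.ball θ ρ, (∀ t ∈ Metric.ball θ ρ, logLik p q t ≤ logLik p q s) →
        ∀ t ∈ Metric.ball θ ρ, logLik p q t ≤ logLik p q s - c / 2 * fisherForm p θ (t - s) := by
  have hpos : 0 < (1 - c) * m := mul_pos (by linarith) hm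
  obtain ⟨δ, hδ, hball⟩ := exists_abs_sum_mul_apply_sub_le (q₀ := p θ)
    (fun x => tendsto_norm_fderiv_fderiv_sub (h.contDiffAt_log x)) hpos
  obtain ⟨r, hr, hreg⟩ := Metric.eventually_nhds_iff_ball.1 h.eventually_isRegularAt
  obtain ⟨w, hw, hwW⟩ := Metric.mem_nhds_iff.1 hW
  refine ⟨min δ (min r w), by positivity,
    (Metric.ball_subset_ball ((min_le_right _ _).trans (min_le_right _ _))).trans hwW,
    δ, hδ, fun q hq s hs hmax t ht => ?_⟩
  have hreg' : ∀ u ∈ Metric.ball θ (min δ (min r w)), IsRegularAt p u := fun u hu =>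
    hreg u (Metric.ball_subset_ball ((min_le_right _ _).trans (min_le_left _ _)) hu)
  have hcrit : fderiv ℝ (logLik p q) s = 0 :=
    IsLocalMax.fderiv_eq_zero ((Metric.isOpen_ball.eventually_mem hs).mono hmax)
  have := apply_le_sub_half_of_fderiv_fderiv_le (f := logLik p q) (convex_ball θ _)
    (fun u hu => (hreg' u hu).contDiffAt_logLik q) hs ht hcrit
    (K := c * fisherForm p θ (t - s)) fun u hu => ?_
  · linarith
  -- The perturbation `(1 - c) m ‖t - s‖²` is at most `(1 - c)` times the Fisher form, so a fraction
  -- `c` of the concavity survives.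
  have e1 := hball q hq u (Metric.ball_subset_ball (min_le_left _ _) hu) (t - s)
  rw [← (hreg' u hu).fderiv_fderiv_logLik_apply, ← h.fderiv_fderiv_logLik_apply,
    h.fderiv_fderiv_logLik_self] at e1
  have e2 := (abs_le.1 e1).2
  nlinarith [mul_le_mul_of_nonneg_left (hF (t - s)) (show 0 ≤ 1 - c by linarith)]

end IsRegularAt

end LogLikelihood

/-! ### From matrices to second derivatives -/

section Forms

open Matrix

variable {k : ℕ}

theorem clm_apply_eq_sum (φ : EuclideanSpace ℝ (Fin k) →L[ℝ] ℝ) (v : EuclideanSpace ℝ (Fin k)) :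
    φ v = ∑ i, v i * φ (EuclideanSpace.single i 1) := by
  conv_lhs => rw [← (EuclideanSpace.basisFun (Fin k) ℝ).sum_repr v]
  simp [map_sum]

theorem dotProduct_fisherMatrix_mulVec {Ω : Type*} [Fintype Ω]
    (p : EuclideanSpace ℝ (Fin k) → Ω → ℝ) (θ v : EuclideanSpace ℝ (Fin k)) :
    v.ofLp ⬝ᵥ fisherMatrix p θ *ᵥ v.ofLp = fisherForm p θ v := by
  have h : ∀ x, (fderiv ℝ (fun t => Real.log (p t x)) θ v) ^ 2 = ∑ i, ∑ j,
      v i * (v j * (partialDeriv i (fun t => Real.log (p t x)) θ *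
        partialDeriv j (fun t => Real.log (p t x)) θ)) := by
    intro x
    rw [pow_two, clm_apply_eq_sum, Finset.sum_mul_sum]
    exact Finset.sum_congr rfl fun i _ => Finset.sum_congr rfl fun j _ => by
      unfold partialDeriv; ring
  simp only [fisherForm, h, dotProduct, mulVec, fisherMatrix, Matrix.of_apply, Finset.mul_sum,
    Finset.sum_mul]
  rw [Finset.sum_comm]
  conv_rhs => rw [Finset.sum_comm]
  rw [Finset.sum_comm]
  refine Finset.sum_congr rfl fun i _ => ?_
  conv_rhs => rw [Finset.sum_comm]
  exact Finset.sum_congr rfl fun j _ => Finset.sum_congr rfl fun x _ => by ring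

theorem hesseMatrix_apply
    {Δ : EuclideanSpace ℝ (Fin k) → EuclideanSpace ℝ (Fin k) → ℝ} {θ : EuclideanSpace ℝ (Fin k)}
    (h : ContDiffAt ℝ 2 (fun s => Δ s θ) θ) (i j : Fin k) :
    hesseMatrix Δ θ i j = fderiv ℝ (fderiv ℝ (fun s => Δ s θ)) θ (EuclideanSpace.single i 1)
      (EuclideanSpace.single j 1) := by
  have := (hasFDerivAt_fderiv_of_contDiffAt h).clm_apply
    (hasFDerivAt_const (EuclideanSpace.single j (1 : ℝ)) θ)
  unfold hesseMatrix partialDeriv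
  rw [Matrix.of_apply, this.fderiv]
  simp

theorem isHermitian_hesseMatrix
    {Δ : EuclideanSpace ℝ (Fin k) → EuclideanSpace ℝ (Fin k) → ℝ} {θ : EuclideanSpace ℝ (Fin k)}
    (h : ContDiffAt ℝ 2 (fun s => Δ s θ) θ) : (hesseMatrix Δ θ).IsHermitian := by
  ext i j
  rw [conjTranspose_apply, star_trivial, hesseMatrix_apply h, hesseMatrix_apply h]
  exact h.isSymmSndFDerivAt (by simp) _ _

theorem posSemidef_fisherMatrix {Ω : Type*} [Fintype Ω]
    {p : EuclideanSpace ℝ (Fin k) → Ω → ℝ} {θ : EuclideanSpace ℝ (Fin k)}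
    (hp : ∀ x, 0 ≤ p θ x) : (fisherMatrix p θ).PosSemidef := by
  refine posSemidef_iff_dotProduct_mulVec.2 ⟨?_, fun v => ?_⟩
  · ext i j
    rw [conjTranspose_apply, star_trivial]
    unfold fisherMatrix
    simp only [Matrix.of_apply]
    exact Finset.sum_congr rfl fun x _ => by ring
  · have := dotProduct_fisherMatrix_mulVec p θ (WithLp.toLp 2 v)
    simp only [star_trivial] at this ⊢
    rw [this]
    exact Finset.sum_nonneg fun x _ => mul_nonneg (hp x) (sq_nonneg _)

theorem dotProduct_hesseMatrix_mulVec
    {Δ : EuclideanSpace ℝ (Fin k) → EuclideanSpace ℝ (Fin k) → ℝ} {θ : EuclideanSpace ℝ (Fin k)}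
    (h : ContDiffAt ℝ 2 (fun s => Δ s θ) θ) (v : EuclideanSpace ℝ (Fin k)) :
    v.ofLp ⬝ᵥ hesseMatrix Δ θ *ᵥ v.ofLp =
      fderiv ℝ (fderiv ℝ (fun s => Δ s θ)) θ v v := by
  have hij := hesseMatrix_apply h
  rw [clm_apply_eq_sum (fderiv ℝ (fderiv ℝ (fun s => Δ s θ)) θ v)]
  have hflip : ∀ w, fderiv ℝ (fderiv ℝ (fun s => Δ s θ)) θ v w =
      ∑ i, v i * fderiv ℝ (fderiv ℝ (fun s => Δ s θ)) θ (EuclideanSpace.single i 1) w := fun w =>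
    clm_apply_eq_sum ((fderiv ℝ (fderiv ℝ (fun s => Δ s θ)) θ).flip w) v
  simp only [hflip, dotProduct, mulVec, hij, Finset.mul_sum]
  rw [Finset.sum_comm]
  exact Finset.sum_congr rfl fun j _ => Finset.sum_congr rfl fun i _ => by ring

theorem fderiv_eq_zero_of_isPseudoDistanceOn {Θ : Set (EuclideanSpace ℝ (Fin k))}
    {Δ : EuclideanSpace ℝ (Fin k) → EuclideanSpace ℝ (Fin k) → ℝ} (hΔ : IsPseudoDistanceOn Θ Δ)
    {θ : EuclideanSpace ℝ (Fin k)} (hθ : θ ∈ interior Θ) :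
    fderiv ℝ (fun s => Δ s θ) θ = 0 := by
  have hmem : θ ∈ Θ := interior_subset hθ
  refine IsLocalMin.fderiv_eq_zero ?_
  filter_upwards [mem_interior_iff_mem_nhds.1 hθ] with s hs
  rw [hΔ.self_eq_zero θ hmem]
  exact hΔ.nonneg s hs θ hmem

/-- Along each ray the form is twice the limit of the nonnegative quotients `Δ (θ + ε v) θ / ε²`. -/
theorem posSemidef_hesseMatrix {Θ : Set (EuclideanSpace ℝ (Fin k))}
    {Δ : EuclideanSpace ℝ (Fin k) → EuclideanSpace ℝ (Fin k) → ℝ} (hΔ : IsPseudoDistanceOn Θ Δ)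
    {θ : EuclideanSpace ℝ (Fin k)} (hθ : θ ∈ interior Θ)
    (h : ContDiffAt ℝ 2 (fun s => Δ s θ) θ) : (hesseMatrix Δ θ).PosSemidef := by
  have hmem : θ ∈ Θ := interior_subset hθ
  refine posSemidef_iff_dotProduct_mulVec.2 ⟨isHermitian_hesseMatrix h, fun v => ?_⟩
  have h1 := dotProduct_hesseMatrix_mulVec h (WithLp.toLp 2 v)
  simp only [star_trivial] at h1 ⊢
  rw [h1]
  have h2 := tendsto_div_sq_along_ray h (fderiv_eq_zero_of_isPseudoDistanceOn hΔ hθ)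
    (hΔ.self_eq_zero θ hmem) (WithLp.toLp 2 v)
  have hray := tendsto_add_smul θ (WithLp.toLp 2 v)
  have h3 := ge_of_tendsto h2 (b := 0) <| by
    filter_upwards [hray.eventually (mem_interior_iff_mem_nhds.1 hθ)] with ε hε
    exact div_nonneg (hΔ.nonneg _ hε θ hmem) (sq_nonneg _)
  linarith

end Forms

/-! ### Identifiability, localization and consistency -/

section Model

variable {k : ℕ} {Ω : Type*} [Fintype Ω] {Θ : Set (EuclideanSpace ℝ (Fin k))}
  {p : EuclideanSpace ℝ (Fin k) → Ω → ℝ}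
  {Δ : EuclideanSpace ℝ (Fin k) → EuclideanSpace ℝ (Fin k) → ℝ}
  {θ : EuclideanSpace ℝ (Fin k)}

theorem IsSmoothModel.mem_stdSimplex (hp : IsSmoothModel Θ p) {t : EuclideanSpace ℝ (Fin k)}
    (ht : t ∈ Θ) : p t ∈ stdSimplex ℝ Ω :=
  ⟨hp.nonneg t ht, hp.sum_eq_one t ht⟩

theorem IsSmoothModel.isRegularAt (hp : IsSmoothModel Θ p) (hθ : θ ∈ interior Θ)
    (hsupp : ∀ x, p θ x = 0 → ∀ᶠ t in 𝓝 θ, p t x = 0) : IsRegularAt p θ where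
  mem_stdSimplex := by
    filter_upwards [mem_interior_iff_mem_nhds.1 hθ] with t ht
    exact hp.mem_stdSimplex ht
  contDiffAt x := by
    have h : ContDiffOn ℝ (2 : ℕ∞) (fun t => p t x) (interior Θ) :=
      contDiffOn_of_differentiableOn fun m hm =>
        (hp.thriceDifferentiableOn x m (by exact_mod_cast hm)).congr fun t ht =>
          iteratedFDerivWithin_of_isOpen m isOpen_interior ht
    exact h.contDiffAt (isOpen_interior.mem_nhds hθ)
  eventually_eq_zero := hsupp

/-- Affinity against squared Hellinger distance: the affinity of distinct distributions is below
`1`. Unlike the log-likelihood, it stays continuous where probabilities vanish. -/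
theorem two_mul_one_sub_sum_sqrt {p q : Ω → ℝ} (hp : p ∈ stdSimplex ℝ Ω)
    (hq : q ∈ stdSimplex ℝ Ω) :
    2 * (1 - ∑ x, √(p x) * √(q x)) = ∑ x, (√(p x) - √(q x)) ^ 2 := by
  have h : ∀ x, (√(p x) - √(q x)) ^ 2 = p x + q x - 2 * (√(p x) * √(q x)) := fun x => by
    rw [sub_sq, Real.sq_sqrt (hp.1 x), Real.sq_sqrt (hq.1 x)]; ring
  simp only [h, Finset.sum_sub_distrib, Finset.sum_add_distrib, hp.2, hq.2, ← Finset.mul_sum]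
  ring

/-- If the empirical distribution `q` is close to `p t`, the parameter `t` is more likely than
every parameter in a compact set that does not contain it. -/
theorem exists_sum_mul_log_sub_log_neg (hp : IsSmoothModel Θ p) {t : EuclideanSpace ℝ (Fin k)}
    (ht : t ∈ Θ) {K : Set (EuclideanSpace ℝ (Fin k))} (hK : IsCompact K) (hKΘ : K ⊆ Θ)
    (hid : ∀ s ∈ K, ∃ x, p t x ≠ p s x) :
    ∃ η > 0, ∀ q ∈ stdSimplex ℝ Ω, (∀ x, p t x = 0 → q x = 0) → (∀ x, |q x - p t x| < η) →
      ∀ s ∈ K, (∀ x, 0 < q x → 0 < p s x) →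
        ∑ x, q x * (Real.log (p s x) - Real.log (p t x)) < 0 := by
  -- By compactness the affinity with `p t` attains its maximum on `K`, and identifiability keeps it
  -- below `1`.
  have hgap : ∃ c > 0, ∀ s ∈ K, ∑ x, √(p s x) * √(p t x) ≤ 1 - c := by
    rcases K.eq_empty_or_nonempty with rfl | hne
    · exact ⟨1, one_pos, by simp⟩
    have hcont : ContinuousOn (fun s => ∑ x, √(p s x) * √(p t x)) K :=
      continuousOn_finsetSum _ fun x _ =>
        (((hp.continuousOn x).mono hKΘ).sqrt).mul continuousOn_const
    obtain ⟨s₀, hs₀, hmax⟩ := hK.exists_isMaxOn hne hcont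
    refine ⟨1 - ∑ x, √(p s₀ x) * √(p t x), ?_, fun s hs => by
      have := hmax hs
      simp only [Set.mem_ofPred_eq] at this
      linarith⟩
    have h1 := two_mul_one_sub_sum_sqrt (hp.mem_stdSimplex (hKΘ hs₀)) (hp.mem_stdSimplex ht)
    have h2 : 0 < ∑ x, (√(p s₀ x) - √(p t x)) ^ 2 := by
      obtain ⟨x, hx⟩ := hid s₀ hs₀
      refine Finset.sum_pos' (fun _ _ => sq_nonneg _) ⟨x, Finset.mem_univ x, ?_⟩
      refine sq_pos_iff.2 fun h => hx ?_
      have := congrArg (· ^ 2) (sub_eq_zero.1 h)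
      simp only [Real.sq_sqrt (hp.nonneg _ (hKΘ hs₀) x), Real.sq_sqrt (hp.nonneg _ ht x)] at this
      exact this.symm
    linarith
  obtain ⟨c, hc, hgap⟩ := hgap
  have hM : 0 ≤ ∑ x, (√(p t x))⁻¹ := Finset.sum_nonneg fun x _ => by positivity
  refine ⟨c / (∑ x, (√(p t x))⁻¹ + 1), by positivity, fun q hq hsupp hnear s hs hpos => ?_⟩
  set η := c / (∑ x, (√(p t x))⁻¹ + 1) with hη
  have hη0 : 0 < η := by positivity
  -- From `log r ≤ 2 (√r - 1)` and `q x ≤ p t x + η`. Summed, the bound is twice affinity plus `η ∑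
  -- (√(p t x))⁻¹` minus `1`, and `η` is chosen so that the middle term is below the gap `c`.
  have hterm : ∀ x, q x * (Real.log (p s x) - Real.log (p t x)) ≤
      2 * (√(p s x) * √(p t x) + η * (√(p t x))⁻¹ - q x) := by
    intro x
    have hps := hp.nonneg s (hKΘ hs) x
    rcases (hq.1 x).eq_or_lt with h0 | h0
    · rw [← h0]
      simp only [zero_mul, sub_zero]
      positivity
    have hs0 := hpos x h0
    have ht0 : 0 < p t x := lt_of_le_of_ne (hp.nonneg t ht x) fun h => h0.ne' (hsupp x h.symm)
    have hl : Real.log (p s x) - Real.log (p t x) ≤ 2 * (√(p s x) / √(p t x) - 1) := by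
      have h1 := Real.log_le_sub_one_of_pos (div_pos (Real.sqrt_pos.2 hs0) (Real.sqrt_pos.2 ht0))
      rw [Real.log_div (Real.sqrt_pos.2 hs0).ne' (Real.sqrt_pos.2 ht0).ne',
        Real.log_sqrt hs0.le, Real.log_sqrt ht0.le] at h1
      linarith
    have hs1 : √(p s x) ≤ 1 := by
      refine Real.sqrt_le_one.2 ?_
      exact (hp.sum_eq_one s (hKΘ hs)) ▸ Finset.single_le_sum
        (fun y _ => hp.nonneg s (hKΘ hs) y) (Finset.mem_univ x)
    have hqle : q x ≤ p t x + η := by linarith [(abs_lt.1 (hnear x)).2]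
    have h2 : q x * (√(p s x) / √(p t x)) ≤ (p t x + η) * (√(p s x) / √(p t x)) :=
      mul_le_mul_of_nonneg_right hqle (by positivity)
    have h3 : p t x * (√(p s x) / √(p t x)) = √(p s x) * √(p t x) := by
      have := Real.mul_self_sqrt ht0.le
      have hne := (Real.sqrt_pos.2 ht0).ne'
      field_simp
      rw [pow_two, this]
    have h4 : η * (√(p s x) / √(p t x)) ≤ η * (√(p t x))⁻¹ := by
      rw [div_eq_mul_inv]
      exact mul_le_mul_of_nonneg_left (mul_le_of_le_one_left (by positivity) hs1) hη0.le
    calc q x * (Real.log (p s x) - Real.log (p t x))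
        ≤ q x * (2 * (√(p s x) / √(p t x) - 1)) := mul_le_mul_of_nonneg_left hl h0.le
      _ ≤ _ := by nlinarith
  have hsum := Finset.sum_le_sum fun x (_ : x ∈ Finset.univ) => hterm x
  rw [← Finset.mul_sum, Finset.sum_sub_distrib, Finset.sum_add_distrib, hq.2,
    ← Finset.mul_sum] at hsum
  have h5 : η * ∑ x, (√(p t x))⁻¹ < c := by
    rw [hη, div_mul_eq_mul_div, div_lt_iff₀ (by positivity)]
    nlinarith
  linarith [hgap s hs]

omit [Fintype Ω] in
-- One zero factor would annihilate the larger product. Hence a maximum likelihood estimate charges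
-- every observed letter and logarithms may be taken.
theorem pos_of_prod_le {N : ℕ} {a b : Ω → ℝ} (hb : ∀ x, 0 ≤ b x) {x : Fin N → Ω}
    (ha : ∀ i, 0 < a (x i)) (h : ∏ i, a (x i) ≤ ∏ i, b (x i)) (i : Fin N) : 0 < b (x i) := by
  refine lt_of_le_of_ne (hb _) fun h0 => ?_
  have h1 : ∏ i, b (x i) = 0 := Finset.prod_eq_zero (Finset.mem_univ i) h0.symm
  have h2 : 0 < ∏ i, a (x i) := Finset.prod_pos fun i _ => ha i
  linarith

theorem sum_freq_mul_log_nonneg {N : ℕ} (hN : 0 < N) {a b : Ω → ℝ} {x : Fin N → Ω}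
    (ha : ∀ i, 0 < a (x i)) (hb : ∀ i, 0 < b (x i)) (h : ∏ i, a (x i) ≤ ∏ i, b (x i)) :
    0 ≤ ∑ y, freq x y * (Real.log (b y) - Real.log (a y)) := by
  have h1 := Real.log_le_log (Finset.prod_pos fun i _ => ha i) h
  rw [Real.log_prod fun i _ => (ha i).ne', Real.log_prod fun i _ => (hb i).ne'] at h1
  have h2 := sum_apply_eq_freq x fun y => Real.log (b y) - Real.log (a y)
  rw [Finset.sum_sub_distrib] at h2
  have h3 : (0 : ℝ) < N := Nat.cast_pos.2 hN
  by_contra hcon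
  nlinarith [mul_neg_of_pos_of_neg h3 (not_le.1 hcon)]

/-- For typical sequences a maximum likelihood estimate avoids every compact set that does not
contain the true parameter. -/
theorem exists_maxLikelihood_notMem (hp : IsSmoothModel Θ p) {t : EuclideanSpace ℝ (Fin k)}
    (ht : t ∈ Θ) {K : Set (EuclideanSpace ℝ (Fin k))} (hK : IsCompact K) (hKΘ : K ⊆ Θ)
    (hid : ∀ s ∈ K, ∃ x, p t x ≠ p s x) {ml : (N : ℕ) → (Fin N → Ω) → EuclideanSpace ℝ (Fin k)}
    (hml : IsMaxLikelihoodEstimator Θ p ml) :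
    ∃ η > 0, ∀ N, 0 < N → ∀ x : Fin N → Ω, (∀ i, 0 < p t (x i)) →
      (∀ y, |freq x y - p t y| < η) → ml N x ∉ K := by
  obtain ⟨η, hη, h⟩ := exists_sum_mul_log_sub_log_neg hp ht hK hKΘ hid
  refine ⟨η, hη, fun N hN x hx hnear hmem => ?_⟩
  have hle := (hml N x).2 t ht
  have hpos := pos_of_prod_le (hp.nonneg _ (hml N x).1) hx hle
  have h1 := h _ (freq_mem_stdSimplex hN x) (fun y hy => freq_eq_zero_of_pos hx hy) hnear _ hmem
    fun y hy => by
      by_contra hcon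
      refine hy.ne' (freq_eq_zero_of_forall_ne fun i hi => hcon (hi ▸ hpos i))
  exact absurd (sum_freq_mul_log_nonneg hN hx hpos hle) (not_le.2 h1)

theorem isCompact_setOf_le (hΘ : IsCompact Θ) {f : EuclideanSpace ℝ (Fin k) → ℝ}
    (hf : ContinuousOn f Θ) (δ : ℝ) : IsCompact {s | s ∈ Θ ∧ δ ≤ f s} := by
  have := hf.preimage_isClosed_of_isClosed hΘ.isClosed (isClosed_Ici (a := δ))
  exact hΘ.of_isClosed_subset this Set.inter_subset_left

/-- The set where `Δ · t ≥ δ` is compact and misses `t`, so typical sequences never send the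
estimate there. -/
theorem IsMaxLikelihoodEstimator.isConsistent (hΘ : IsCompact Θ) (hp : IsSmoothModel Θ p)
    (hΔ : IsPseudoDistanceOn Θ Δ) (hΔ_cont : ∀ t ∈ Θ, ContinuousOn (fun s => Δ s t) Θ)
    (hid : Identifiable Θ p) {ml : (N : ℕ) → (Fin N → Ω) → EuclideanSpace ℝ (Fin k)}
    (hml : IsMaxLikelihoodEstimator Θ p ml) : IsConsistent Θ p Δ ml := by
  intro t ht δ hδ
  have ht' := interior_subset ht
  obtain ⟨η, hη, h⟩ := exists_maxLikelihood_notMem hp ht'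
    (isCompact_setOf_le hΘ (hΔ_cont t ht') δ) (fun s hs => hs.1) (fun s hs => hid t ht s hs.1 <| by
      rintro rfl
      have := hs.2
      rw [hΔ.self_eq_zero t ht'] at this
      linarith) hml
  have hq := hp.mem_stdSimplex ht'
  refine squeeze_zero' (Eventually.of_forall fun N => seqProb_nonneg hq.1 N _) ?_
    (tendsto_seqProb_far hq hη)
  filter_upwards [eventually_gt_atTop 0] with N hN
  refine seqProb_mono hq.1 fun x hx hΔx => ?_
  by_contra! hcon
  exact h N hN x hx hcon ⟨(hml N x).1, hΔx.le⟩

/-- A consistent estimator eventually falls on the right side of a threshold at `θ`, under a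
parameter `t` that lies beyond it. -/
theorem IsConsistent.tendsto_seqProb_not (hΘ : IsCompact Θ) (hp : IsSmoothModel Θ p)
    (hΔ : IsPseudoDistanceOn Θ Δ) (hΔ_cont : ∀ t ∈ Θ, ContinuousOn (fun s => Δ s t) Θ)
    (hθ : θ ∈ Θ) {est : (N : ℕ) → (Fin N → Ω) → EuclideanSpace ℝ (Fin k)}
    (hest : IsEstimator Θ est) (hcons : IsConsistent Θ p Δ est) {t : EuclideanSpace ℝ (Fin k)}
    (ht : t ∈ interior Θ) {δ : ℝ} (hδ : δ < Δ t θ) :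
    Tendsto (fun N => seqProb (p t) N (fun x => ¬ δ < Δ (est N x) θ)) atTop (𝓝 0) := by
  have ht' := interior_subset ht
  have hq := hp.mem_stdSimplex ht'
  have hK := isCompact_setOf_le hΘ (hΔ_cont θ hθ).neg (-δ)
  -- Without a triangle inequality, the separation comes from compactness: `Δ · t` has a positive
  -- minimum on the sublevel set, which does not contain `t`.
  have hgap : ∃ d > 0, ∀ s ∈ Θ, Δ s θ ≤ δ → d < Δ s t := by
    rcases Set.eq_empty_or_nonempty {s | s ∈ Θ ∧ -δ ≤ -Δ s θ} with hE | hne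
    · refine ⟨1, one_pos, fun s hs hs' => ?_⟩
      have : s ∈ {s | s ∈ Θ ∧ -δ ≤ -Δ s θ} := ⟨hs, by linarith⟩
      rw [hE] at this
      exact this.elim
    obtain ⟨s₀, hs₀, hmin⟩ := hK.exists_isMinOn hne ((hΔ_cont t ht').mono fun s hs => hs.1)
    have hpos : 0 < Δ s₀ t := by
      refine lt_of_le_of_ne (hΔ.nonneg _ hs₀.1 _ ht') fun h0 => ?_
      have := hΔ.eq_of_eq_zero _ hs₀.1 _ ht' h0.symm
      have h2 := hs₀.2
      rw [this] at h2
      simp only [Pi.neg_apply] at h2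
      linarith
    refine ⟨Δ s₀ t / 2, by linarith, fun s hs hs' => ?_⟩
    have : Δ s₀ t ≤ Δ s t := hmin (show s ∈ {s | s ∈ Θ ∧ -δ ≤ -Δ s θ} from ⟨hs, by linarith⟩)
    linarith
  obtain ⟨d, hd, hgap⟩ := hgap
  refine squeeze_zero (fun N => seqProb_nonneg hq.1 N _) (fun N => ?_) (hcons t ht d hd)
  exact seqProb_mono hq.1 fun x _ hx => hgap _ (hest N x) (not_lt.1 hx)

end Model

/-! ### Normalized logarithms in the extended reals -/

section ExtendedReals

variable {k : ℕ} {Ω : Type*} [Fintype Ω]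
  {p : EuclideanSpace ℝ (Fin k) → Ω → ℝ}
  {Δ : EuclideanSpace ℝ (Fin k) → EuclideanSpace ℝ (Fin k) → ℝ}
  {est : (N : ℕ) → (Fin N → Ω) → EuclideanSpace ℝ (Fin k)}
  {θ : EuclideanSpace ℝ (Fin k)}

theorem le_scaledLogError {ε : ℝ} (hε : 0 < ε) {N : ℕ} (hN : 0 < N) {E : ℝ}
    (h : Real.exp (-(E * N)) ≤ errorProb p Δ est θ (ε ^ 2) N) :
    ((-(E / ε ^ 2) : ℝ) : EReal) ≤ scaledLogError p Δ est θ ε N := by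
  have hpos := (Real.exp_pos _).trans_le h
  have hN' : (0 : ℝ) < N := Nat.cast_pos.2 hN
  rw [scaledLogError, ENNReal.log_ofReal, if_neg hpos.not_ge, ← EReal.coe_mul, EReal.coe_le_coe_iff]
  have h1 := (Real.le_log_iff_exp_le hpos).2 h
  have h2 : -(E / ε ^ 2) = 1 / (ε ^ 2 * N) * -(E * N) := by field_simp
  rw [h2]
  exact mul_le_mul_of_nonneg_left h1 (by positivity)

theorem scaledLogError_le {ε : ℝ} (hε : 0 < ε) {N : ℕ} (hN : 0 < N) {E : ℝ}
    (h : errorProb p Δ est θ (ε ^ 2) N ≤ Real.exp (-(E * N))) :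
    scaledLogError p Δ est θ ε N ≤ ((-(E / ε ^ 2) : ℝ) : EReal) := by
  have hN' : (0 : ℝ) < N := Nat.cast_pos.2 hN
  have hc : 0 < 1 / (ε ^ 2 * N) := by positivity
  rw [scaledLogError, ENNReal.log_ofReal]
  split_ifs with h0
  · rw [EReal.coe_mul_bot_of_pos hc]
    exact bot_le
  · rw [← EReal.coe_mul, EReal.coe_le_coe_iff]
    have h1 := (Real.log_le_iff_le_exp (not_le.1 h0)).2 h
    have h2 : -(E / ε ^ 2) = 1 / (ε ^ 2 * N) * -(E * N) := by field_simp
    rw [h2]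
    exact mul_le_mul_of_nonneg_left h1 hc.le

theorem eventually_le_scaledLogError {ε : ℝ} (hε : 0 < ε) {E : ℝ}
    (h : ∀ᶠ N : ℕ in atTop, Real.exp (-(E * N)) ≤ errorProb p Δ est θ (ε ^ 2) N) :
    ∀ᶠ N : ℕ in atTop, ((-(E / ε ^ 2) : ℝ) : EReal) ≤ scaledLogError p Δ est θ ε N := by
  filter_upwards [h, eventually_gt_atTop 0] with N h1 hN using le_scaledLogError hε hN h1

theorem eventually_scaledLogError_le {ε : ℝ} (hε : 0 < ε) {E : ℝ}
    (h : ∀ᶠ N : ℕ in atTop, errorProb p Δ est θ (ε ^ 2) N ≤ Real.exp (-(E * N))) :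
    ∀ᶠ N : ℕ in atTop, scaledLogError p Δ est θ ε N ≤ ((-(E / ε ^ 2) : ℝ) : EReal) := by
  filter_upwards [h, eventually_gt_atTop 0] with N h1 hN using scaledLogError_le hε hN h1

theorem tendsto_scaledLogError {ε : ℝ} (hε : 0 < ε) {E : ℝ}
    (hlower : ∀ E' > E, ∀ᶠ N : ℕ in atTop,
      Real.exp (-(E' * N)) ≤ errorProb p Δ est θ (ε ^ 2) N)
    (hupper : ∀ E' < E, ∀ᶠ N : ℕ in atTop,
      errorProb p Δ est θ (ε ^ 2) N ≤ Real.exp (-(E' * N))) :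
    Tendsto (fun N : ℕ => scaledLogError p Δ est θ ε N) atTop
      (𝓝 ((-(E / ε ^ 2) : ℝ) : EReal)) := by
  have hε2 : 0 < ε ^ 2 := by positivity
  have hr : ∀ r : ℝ, -((-r * ε ^ 2) / ε ^ 2) = r := fun r => by field_simp
  refine tendsto_order.2 ⟨fun a ha => ?_, fun a ha => ?_⟩
  · obtain ⟨r, har, hrE⟩ := EReal.lt_iff_exists_real_btwn.1 ha
    rw [EReal.coe_lt_coe_iff] at hrE
    have h1 : -r * ε ^ 2 > E := by
      have := (div_lt_iff₀ hε2).1 (show E / ε ^ 2 < -r by linarith)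
      linarith
    filter_upwards [eventually_le_scaledLogError hε (hlower _ h1)] with N hN
    rw [hr] at hN
    exact har.trans_le hN
  · obtain ⟨r, hrE, har⟩ := EReal.lt_iff_exists_real_btwn.1 ha
    rw [EReal.coe_lt_coe_iff] at hrE
    have h1 : -r * ε ^ 2 < E := by
      have := (lt_div_iff₀ hε2).1 (show -r < E / ε ^ 2 by linarith)
      linarith
    filter_upwards [eventually_scaledLogError_le hε (hupper _ h1)] with N hN
    rw [hr] at hN
    exact hN.trans_lt har

theorem exponentBound_of_pos {H F : Matrix (Fin k) (Fin k) ℝ}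
    (h : 0 < maxEigenvalue (sandwich H F)) :
    exponentBound H F = ((-(1 / maxEigenvalue (sandwich H F)) : ℝ) : EReal) := by
  have h1 : (ENNReal.ofReal (maxEigenvalue (sandwich H F)))⁻¹ =
      ENNReal.ofReal (1 / maxEigenvalue (sandwich H F)) := by
    rw [one_div, ENNReal.ofReal_inv_of_pos h]
  unfold exponentBound
  change -(((ENNReal.ofReal (maxEigenvalue (sandwich H F)))⁻¹ : ENNReal) : EReal) = _
  rw [h1, EReal.coe_ennreal_ofReal, max_eq_left (by positivity), EReal.coe_neg]

theorem exponentBound_of_nonpos {H F : Matrix (Fin k) (Fin k) ℝ}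
    (h : maxEigenvalue (sandwich H F) ≤ 0) : exponentBound H F = ⊥ := by
  unfold exponentBound
  change -(((ENNReal.ofReal (maxEigenvalue (sandwich H F)))⁻¹ : ENNReal) : EReal) = _
  rw [ENNReal.ofReal_of_nonpos h]
  simp

end ExtendedReals

/-! ### The lower bound for consistent estimators -/

section LowerBound

variable {k : ℕ} {Ω : Type*} [Fintype Ω] {Θ : Set (EuclideanSpace ℝ (Fin k))}
  {p : EuclideanSpace ℝ (Fin k) → Ω → ℝ}
  {Δ : EuclideanSpace ℝ (Fin k) → EuclideanSpace ℝ (Fin k) → ℝ}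
  {θ : EuclideanSpace ℝ (Fin k)}

/-- The error probability of a consistent estimator, bounded along a direction of parameters. -/
theorem IsConsistent.eventually_exp_le_errorProb_of_direction (hΘ : IsCompact Θ)
    (hp : IsSmoothModel Θ p) (hΔ : IsPseudoDistanceOn Θ Δ)
    (hΔ_cont : ∀ t ∈ Θ, ContinuousOn (fun s => Δ s t) Θ) (hθ : θ ∈ interior Θ)
    (hreg : IsRegularAt p θ) (hΔ_smooth : ContDiffAt ℝ 2 (fun s => Δ s θ) θ)
    {est : (N : ℕ) → (Fin N → Ω) → EuclideanSpace ℝ (Fin k)} (hest : IsEstimator Θ est)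
    (hcons : IsConsistent Θ p Δ est) (v : EuclideanSpace ℝ (Fin k))
    (hv : 1 < fderiv ℝ (fderiv ℝ (fun s => Δ s θ)) θ v v / 2) {b : ℝ}
    (hb : fisherForm p θ v / 2 < b) :
    ∀ᶠ ε in 𝓝[>] (0 : ℝ), ∀ᶠ N : ℕ in atTop,
      Real.exp (-(b * ε ^ 2 * N)) ≤ errorProb p Δ est θ (ε ^ 2) N := by
  have hmem := interior_subset hθ
  have h1 := tendsto_div_sq_along_ray hΔ_smooth (fderiv_eq_zero_of_isPseudoDistanceOn hΔ hθ)
    (hΔ.self_eq_zero θ hmem) v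
  have h2 := hreg.tendsto_relEntropy_div_sq v
  have hray := tendsto_add_smul θ v
  filter_upwards [h1.eventually (lt_mem_nhds hv), h2.eventually (gt_mem_nhds hb),
    hray.eventually (isOpen_interior.mem_nhds hθ), hray.eventually hreg.eventually_zero,
    self_mem_nhdsWithin] with ε e1 e2 e3 e4 hε
  have hε2 : 0 < ε ^ 2 := pow_pos hε 2
  rw [lt_div_iff₀ hε2, one_mul] at e1
  rw [div_lt_iff₀ hε2] at e2
  exact eventually_exp_le_seqProb (hp.mem_stdSimplex (interior_subset e3)) hreg.mem_self e4
    (hcons.tendsto_seqProb_not hΘ hp hΔ hΔ_cont hmem hest e3 e1) e2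

/-- Rescale the extremal direction of `exists_quadForm_eq` so that its loss just exceeds the
threshold; half its Fisher form then only slightly exceeds `1 / σ`. -/
theorem IsConsistent.eventually_exp_le_errorProb (hΘ : IsCompact Θ)
    (hp : IsSmoothModel Θ p) (hΔ : IsPseudoDistanceOn Θ Δ)
    (hΔ_cont : ∀ t ∈ Θ, ContinuousOn (fun s => Δ s t) Θ) (hθ : θ ∈ interior Θ)
    (hreg : IsRegularAt p θ) (hΔ_smooth : ContDiffAt ℝ 2 (fun s => Δ s θ) θ)
    {est : (N : ℕ) → (Fin N → Ω) → EuclideanSpace ℝ (Fin k)} (hest : IsEstimator Θ est)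
    (hcons : IsConsistent Θ p Δ est)
    (hσ : 0 < maxEigenvalue (sandwich (hesseMatrix Δ θ) (fisherMatrix p θ))) {b : ℝ}
    (hb : 1 / maxEigenvalue (sandwich (hesseMatrix Δ θ) (fisherMatrix p θ)) < b) :
    ∀ᶠ ε in 𝓝[>] (0 : ℝ), ∀ᶠ N : ℕ in atTop,
      Real.exp (-(b * ε ^ 2 * N)) ≤ errorProb p Δ est θ (ε ^ 2) N := by
  obtain ⟨v, hv, hvF⟩ := exists_quadForm_eq (posSemidef_hesseMatrix hΔ hθ hΔ_smooth)
    (posSemidef_fisherMatrix hreg.mem_self.1) hσ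
  set σ := maxEigenvalue (sandwich (hesseMatrix Δ θ) (fisherMatrix p θ))
  set w := WithLp.toLp 2 v with hw
  have e1 := dotProduct_hesseMatrix_mulVec hΔ_smooth w
  have e2 := dotProduct_fisherMatrix_mulVec p θ w
  simp only [hw] at e1 e2
  rw [e1] at hv hvF
  rw [e2] at hvF
  rw [← hw] at hv hvF
  set B := fderiv ℝ (fderiv ℝ (fun s => Δ s θ)) θ with hB
  have hf : 0 < fisherForm p θ w := by
    by_contra hcon
    have := mul_nonpos_of_nonneg_of_nonpos hσ.le (not_lt.1 hcon)
    linarith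
  have h1 : 2 / B w w < 2 * b / fisherForm p θ w := by
    rw [div_lt_div_iff₀ hv hf, hvF]
    have := (div_lt_iff₀ hσ).1 hb
    nlinarith
  -- `y` is the squared length factor: the left inequality puts the loss beyond `ε²`, the right one
  -- keeps the entropy rate below `b`.
  obtain ⟨y, hy1, hy2⟩ := exists_between h1
  have hy0 : 0 < y := lt_trans (by positivity) hy1
  have hys : √y * √y = y := Real.mul_self_sqrt hy0.le
  refine hcons.eventually_exp_le_errorProb_of_direction hΘ hp hΔ hΔ_cont hθ hreg hΔ_smooth hest
    (√y • w) ?_ ?_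
  · rw [← hB]
    simp only [map_smul, _root_.smul_apply, smul_eq_mul]
    rw [← mul_assoc, hys]
    have := (div_lt_iff₀ hv).1 hy1
    linarith
  · have e : fisherForm p θ (√y • w) = y * fisherForm p θ w := by
      unfold fisherForm
      rw [Finset.mul_sum]
      refine Finset.sum_congr rfl fun x _ => ?_
      simp only [map_smul, smul_eq_mul]
      rw [mul_pow, Real.sq_sqrt hy0.le]
      ring
    rw [e]
    have := (lt_div_iff₀ hf).1 hy2
    linarith

end LowerBound

/-! ### Good scales and bounds by type counting -/

section UpperBound

variable {k : ℕ} {Ω : Type*} [Fintype Ω] {Θ : Set (EuclideanSpace ℝ (Fin k))}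
  {p : EuclideanSpace ℝ (Fin k) → Ω → ℝ}
  {Δ : EuclideanSpace ℝ (Fin k) → EuclideanSpace ℝ (Fin k) → ℝ}
  {θ : EuclideanSpace ℝ (Fin k)}

theorem sum_mul_log_eq_log_prod {N : ℕ} {a : Ω → ℝ} {x : Fin N → Ω} (ha : ∀ i, 0 < a (x i)) :
    N * ∑ y, freq x y * Real.log (a y) = Real.log (∏ i, a (x i)) := by
  rw [Real.log_prod fun i _ => (ha i).ne', ← sum_apply_eq_freq x fun y => Real.log (a y)]

/-- Gibbs' inequality. -/
theorem logLik_sub_logLik_le_relEntropy {E : Type*} {p : E → Ω → ℝ} {s t : E}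
    (hs : p s ∈ stdSimplex ℝ Ω) {q : Ω → ℝ}
    (hq : q ∈ stdSimplex ℝ Ω) (hqs : ∀ x, 0 < q x → 0 < p s x)
    (hqt : ∀ x, 0 < q x → 0 < p t x) :
    logLik p q s - logLik p q t ≤ relEntropy q (p t) := by
  -- Termwise `log r ≤ r - 1` at `r = p s x / q x`; letters with `q x = 0` only leave `0 ≤ p s x`.
  have h : ∀ x, q x * Real.log (p s x) - q x * Real.log (p t x) - q x * Real.log (q x / p t x) ≤
      p s x - q x := by
    intro x
    rcases (hq.1 x).eq_or_lt with h0 | h0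
    · simpa [← h0] using hs.1 x
    · have h1 := Real.log_le_sub_one_of_pos (div_pos (hqs x h0) h0)
      rw [Real.log_div (hqs x h0).ne' h0.ne'] at h1
      rw [Real.log_div h0.ne' (hqt x h0).ne']
      have h2 := mul_le_mul_of_nonneg_left h1 h0.le
      have h3 : q x * (p s x / q x - 1) = p s x - q x := by field_simp
      linarith
  have := Finset.sum_le_sum fun x (_ : x ∈ Finset.univ) => h x
  simp only [Finset.sum_sub_distrib, hs.2, hq.2] at this
  unfold logLik relEntropy
  linarith

theorem relEntropy_nonneg {q p : Ω → ℝ} (hq : q ∈ stdSimplex ℝ Ω) (hp : p ∈ stdSimplex ℝ Ω)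
    (h : ∀ x, p x = 0 → q x = 0) : 0 ≤ relEntropy q p := by
  have hpos : ∀ x, 0 < q x → 0 < p x := fun x hx =>
    lt_of_le_of_ne (hp.1 x) fun h0 => hx.ne' (h x h0.symm)
  have := logLik_sub_logLik_le_relEntropy (p := fun _ : Unit => p) (s := ()) (t := ()) hp hq
    hpos hpos
  simpa using this

/-- A neighbourhood `ball θ ρ` of `θ` and a neighbourhood of `p θ` on which the maximum likelihood
problem is well behaved, with strong concavity constant `c`. -/
structure IsGoodScale (Θ : Set (EuclideanSpace ℝ (Fin k)))
    (p : EuclideanSpace ℝ (Fin k) → Ω → ℝ) (θ : EuclideanSpace ℝ (Fin k))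
    (ml : (N : ℕ) → (Fin N → Ω) → EuclideanSpace ℝ (Fin k)) (c ρ η : ℝ) : Prop where
  radius_pos : 0 < ρ
  eta_pos : 0 < η
  subset : Metric.ball θ ρ ⊆ Θ
  pos : ∀ t ∈ Metric.ball θ ρ, ∀ x, p θ x ≠ 0 → 0 < p t x
  abs_log_le : ∀ t ∈ Metric.ball θ ρ, ∀ x, |Real.log (p t x)| ≤ |Real.log (p θ x)| + 1
  logLik_le : ∀ q : Ω → ℝ, (∀ x, |q x - p θ x| < η) → ∀ s ∈ Metric.ball θ ρ,
    (∀ t ∈ Metric.ball θ ρ, logLik p q t ≤ logLik p q s) →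
      ∀ t ∈ Metric.ball θ ρ, logLik p q t ≤ logLik p q s - c / 2 * fisherForm p θ (t - s)
  mem_ball : ∀ N, 0 < N → ∀ x : Fin N → Ω, (∀ i, 0 < p θ (x i)) →
    (∀ y, |freq x y - p θ y| < η) → ml N x ∈ Metric.ball θ ρ
  isMax : ∀ N, 0 < N → ∀ x : Fin N → Ω, (∀ i, 0 < p θ (x i)) →
    (∀ y, |freq x y - p θ y| < η) → ∀ t ∈ Metric.ball θ ρ,
      logLik p (freq x) t ≤ logLik p (freq x) (ml N x)

/-- Local regularity fixes the ball. Identifiability on its compact complement then forces typical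
estimates into it, where maximizing the product is maximizing `logLik`. -/
theorem exists_isGoodScale (hΘ : IsCompact Θ) (hp : IsSmoothModel Θ p) (hθ : θ ∈ interior Θ)
    (hreg : IsRegularAt p θ) (hid : Identifiable Θ p)
    {ml : (N : ℕ) → (Fin N → Ω) → EuclideanSpace ℝ (Fin k)}
    (hml : IsMaxLikelihoodEstimator Θ p ml) {m : ℝ} (hm : 0 < m)
    (hF : ∀ v, m * ‖v‖ ^ 2 ≤ fisherForm p θ v) {c : ℝ} (hc : c < 1)
    {W : Set (EuclideanSpace ℝ (Fin k))} (hW : W ∈ 𝓝 θ) :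
    ∃ ρ η, IsGoodScale Θ p θ ml c ρ η ∧ Metric.ball θ ρ ⊆ W := by
  have hlog : ∀ᶠ t in 𝓝 θ, ∀ x, |Real.log (p t x)| ≤ |Real.log (p θ x)| + 1 :=
    eventually_all.2 fun x => ((hreg.contDiffAt_log x).continuousAt.abs.eventually
      (gt_mem_nhds (lt_add_one _))).mono fun t ht => ht.le
  have hW' := (hlog.and hreg.eventually_pos).and
    ((isOpen_interior.eventually_mem hθ).and hW)
  obtain ⟨ρ, hρ, hsub, η₁, hη₁, hconc⟩ := hreg.exists_ball_logLik_le hm hF hc hW'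
  have hcomp : IsCompact (Θ \ Metric.ball θ ρ) := hΘ.diff Metric.isOpen_ball
  obtain ⟨η₂, hη₂, hloc⟩ := exists_maxLikelihood_notMem hp (interior_subset hθ) hcomp
    Set.sdiff_subset (fun s hs => hid θ hθ s hs.1 fun h => hs.2 (by
      rw [← h]; exact Metric.mem_ball_self hρ)) hml
  have hball : ∀ N, 0 < N → ∀ x : Fin N → Ω, (∀ i, 0 < p θ (x i)) →
      (∀ y, |freq x y - p θ y| < min η₁ η₂) → ml N x ∈ Metric.ball θ ρ := by
    intro N hN x hx hnear
    by_contra hcon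
    exact hloc N hN x hx (fun y => (hnear y).trans_le (min_le_right _ _)) ⟨(hml N x).1, hcon⟩
  have hpos : ∀ t ∈ Metric.ball θ ρ, ∀ x, p θ x ≠ 0 → 0 < p t x := fun t ht => (hsub ht).1.2
  refine ⟨ρ, min η₁ η₂, ⟨hρ, lt_min hη₁ hη₂, fun t ht => interior_subset (hsub ht).2.1, hpos,
    fun t ht => (hsub ht).1.1,
    fun q hq => hconc q fun x => (hq x).trans_le (min_le_left _ _), hball, ?_⟩,
    fun t ht => (hsub ht).2.2⟩
  intro N hN x hx hnear t ht
  have hmem := hball N hN x hx hnear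
  have hN' : (0 : ℝ) < N := Nat.cast_pos.2 hN
  refine le_of_mul_le_mul_left ?_ hN'
  unfold logLik
  rw [sum_mul_log_eq_log_prod fun i => hpos t ht _ (hx i).ne',
    sum_mul_log_eq_log_prod fun i => hpos _ hmem _ (hx i).ne']
  exact Real.log_le_log (Finset.prod_pos fun i _ => hpos t ht _ (hx i).ne')
    ((hml N x).2 t (interior_subset (hsub ht).2.1))

theorem eventually_add_le_exp {c₀ C E E' : ℝ} (d : ℕ) (h1 : E' < c₀) (h2 : E' < E) :
    ∀ᶠ N : ℕ in atTop, C * Real.exp (-(c₀ * N)) + (N + 1) ^ d * Real.exp (-(E * N)) ≤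
      Real.exp (-(E' * N)) := by
  have t1 : Tendsto (fun N : ℕ => C * Real.exp (-((c₀ - E') * N))) atTop (𝓝 0) := by
    simpa using (tendsto_exp_neg_mul_nat (sub_pos.2 h1)).const_mul C
  have t2 : Tendsto (fun N : ℕ => ((N : ℝ) + 1) ^ d * Real.exp (-((E - E') * N))) atTop
      (𝓝 0) := by
    have hpos : 0 < E - E' := sub_pos.2 h2
    have h := (tendsto_rpow_mul_exp_neg_mul_atTop_nhds_zero d _ hpos).comp
      (tendsto_natCast_atTop_atTop.atTop_add (tendsto_const_nhds (x := (1 : ℝ)))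
        : Tendsto (fun N : ℕ => (N : ℝ) + 1) atTop atTop)
    -- Compensates for evaluating the exponential at `N + 1` instead of `N`.
    have h' := h.mul_const (Real.exp (E - E'))
    rw [zero_mul] at h'
    refine h'.congr fun N => ?_
    simp only [Function.comp, Real.rpow_natCast]
    rw [mul_assoc, ← Real.exp_add]
    congr 2
    ring
  have t3 := t1.add t2
  rw [add_zero] at t3
  filter_upwards [t3.eventually (gt_mem_nhds one_pos)] with N hN
  have e : ∀ a, Real.exp (-(a * N)) = Real.exp (-((a - E') * N)) * Real.exp (-(E' * N)) :=
    fun a => by rw [← Real.exp_add]; congr 1; ring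
  rw [e c₀, e E, ← mul_assoc, ← mul_assoc, ← add_mul]
  exact mul_le_of_le_one_left (Real.exp_pos _).le hN.le

theorem errorProb_le_of_near (hq : p θ ∈ stdSimplex ℝ Ω) {η : ℝ}
    {ml : (N : ℕ) → (Fin N → Ω) → EuclideanSpace ℝ (Fin k)} {c₀ C : ℝ} {N : ℕ}
    (hfar : seqProb (p θ) N (fun x => ∃ a, η ≤ |freq x a - p θ a|) ≤ C * Real.exp (-(c₀ * N)))
    {δ E : ℝ}
    (h : ∀ x, (∀ i, 0 < p θ (x i)) → (∀ a, |freq x a - p θ a| < η) → δ < Δ (ml N x) θ →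
      E ≤ relEntropy (freq x) (p θ)) :
    errorProb p Δ ml θ δ N ≤
      C * Real.exp (-(c₀ * N)) + (N + 1) ^ Fintype.card Ω * Real.exp (-(E * N)) := by
  refine (seqProb_mono hq.1 (A := fun x => δ < Δ (ml N x) θ) fun x _ hx => ?_).trans
    ((seqProb_or_le hq.1 (fun x => ∃ a, η ≤ |freq x a - p θ a|)
      (fun x => (∀ a, |freq x a - p θ a| < η) ∧ δ < Δ (ml N x) θ)).trans (add_le_add hfar
        (seqProb_le_of_le_relEntropy hq fun x hx hx' => h x hx' hx.1 hx.2)))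
  by_cases hcase : ∃ a, η ≤ |freq x a - p θ a|
  · exact Or.inl hcase
  · push Not at hcase
    exact Or.inr ⟨hcase, hx⟩

end UpperBound

/-! ### Exponents of the maximum likelihood estimator -/

section MaxLikelihood

variable {k : ℕ} {Ω : Type*} [Fintype Ω] {Θ : Set (EuclideanSpace ℝ (Fin k))}
  {p : EuclideanSpace ℝ (Fin k) → Ω → ℝ}
  {Δ : EuclideanSpace ℝ (Fin k) → EuclideanSpace ℝ (Fin k) → ℝ}
  {θ : EuclideanSpace ℝ (Fin k)} {ml : (N : ℕ) → (Fin N → Ω) → EuclideanSpace ℝ (Fin k)}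

theorem fisherForm_sub_comm (p : EuclideanSpace ℝ (Fin k) → Ω → ℝ)
    (θ s t : EuclideanSpace ℝ (Fin k)) : fisherForm p θ (s - t) = fisherForm p θ (t - s) := by
  refine Finset.sum_congr rfl fun x _ => ?_
  rw [map_sub, map_sub]
  ring

theorem exists_pos_mul_norm_sq_le_fisherForm (hp : ∀ x, 0 ≤ p θ x)
    (hu : IsUnit (fisherMatrix p θ)) : ∃ m > 0, ∀ v, m * ‖v‖ ^ 2 ≤ fisherForm p θ v := by
  obtain ⟨m, hm, h⟩ := exists_pos_mul_le_quadForm (posSemidef_fisherMatrix hp) hu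
  refine ⟨m, hm, fun v => ?_⟩
  have h1 := h v.ofLp
  rw [dotProduct_fisherMatrix_mulVec] at h1
  rw [EuclideanSpace.real_norm_sq_eq]
  convert h1 using 2
  exact Finset.sum_congr rfl fun i _ => pow_two _

/-- Strong concavity bounds the log-likelihood gain of the estimate over `θ` from below, Gibbs'
inequality from above. -/
theorem IsGoodScale.half_fisherForm_le_relEntropy {c ρ η : ℝ} (h : IsGoodScale Θ p θ ml c ρ η)
    (hp : IsSmoothModel Θ p) {N : ℕ} (hN : 0 < N) {x : Fin N → Ω} (hx : ∀ i, 0 < p θ (x i))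
    (hnear : ∀ y, |freq x y - p θ y| < η) :
    c / 2 * fisherForm p θ (ml N x - θ) ≤ relEntropy (freq x) (p θ) := by
  have hmem := h.mem_ball N hN x hx hnear
  have hθ := Metric.mem_ball_self (x := θ) h.radius_pos
  have hsupp : ∀ y, 0 < freq x y → p θ y ≠ 0 := fun y hy h0 =>
    hy.ne' (freq_eq_zero_of_pos hx h0)
  have h1 := h.logLik_le _ hnear _ hmem (h.isMax N hN x hx hnear) θ hθ
  have h2 := logLik_sub_logLik_le_relEntropy (p := p) (s := ml N x) (t := θ)
    (hp.mem_stdSimplex (h.subset hmem)) (freq_mem_stdSimplex hN x)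
    (fun y hy => h.pos _ hmem y (hsupp y hy)) (fun y hy => h.pos _ hθ y (hsupp y hy))
  rw [fisherForm_sub_comm] at h1
  linarith

/-- The error probability of a maximum likelihood estimator is asymptotically optimal. -/
theorem IsMaxLikelihoodEstimator.eventually_errorProb_le (hΘ : IsCompact Θ)
    (hp : IsSmoothModel Θ p) (hΔ : IsPseudoDistanceOn Θ Δ) (hθ : θ ∈ interior Θ)
    (hreg : IsRegularAt p θ) (hΔ_smooth : ContDiffAt ℝ 2 (fun s => Δ s θ) θ)
    (hH : hesseMatrix Δ θ ≠ 0) (hid : Identifiable Θ p) (hml : IsMaxLikelihoodEstimator Θ p ml)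
    (hu : IsUnit (fisherMatrix p θ)) {b : ℝ}
    (hb : b < 1 / maxEigenvalue (sandwich (hesseMatrix Δ θ) (fisherMatrix p θ))) :
    ∀ᶠ ε in 𝓝[>] (0 : ℝ), ∀ᶠ N : ℕ in atTop,
      errorProb p Δ ml θ (ε ^ 2) N ≤ Real.exp (-(b * ε ^ 2 * N)) := by
  have hmem := interior_subset hθ
  have hHpsd := posSemidef_hesseMatrix hΔ hθ hΔ_smooth
  have hFpsd := posSemidef_fisherMatrix hreg.mem_self.1
  have hσ := maxEigenvalue_sandwich_pos hHpsd hFpsd hu hH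
  have hHF : ∀ v, fderiv ℝ (fderiv ℝ (fun s => Δ s θ)) θ v v ≤
      maxEigenvalue (sandwich (hesseMatrix Δ θ) (fisherMatrix p θ)) * fisherForm p θ v := by
    intro v
    rw [← dotProduct_hesseMatrix_mulVec hΔ_smooth, ← dotProduct_fisherMatrix_mulVec]
    exact quadForm_le_maxEigenvalue_mul hHpsd hFpsd hu hH _
  set σ := maxEigenvalue (sandwich (hesseMatrix Δ θ) (fisherMatrix p θ))
  obtain ⟨m, hm, hF⟩ := exists_pos_mul_norm_sq_le_fisherForm hreg.mem_self.1 hu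
  obtain ⟨b', hb', hb'σ⟩ := exists_between
    (max_lt hb (show 0 < 1 / σ by positivity) : max b 0 < 1 / σ)
  have hb'0 : 0 < b' := (le_max_right _ _).trans_lt hb'
  have hbb' : b < b' := (le_max_left _ _).trans_lt hb'
  have hbσ1 : b' * σ < 1 := (lt_div_iff₀ hσ).1 hb'σ
  obtain ⟨c, hc, hc1⟩ := exists_between hbσ1
  -- Chosen so that `c = b' (σ + κ)`: `κ` is the room for the Taylor error of `Δ`, and `c < 1` the
  -- concavity constant. An error then gives `ε² ≤ (σ + κ) F(v) / 2`, that is, relative entropy at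
  -- least `b' ε²`.
  set κ := (c - b' * σ) / b' with hκ
  have hκ0 : 0 < κ := div_pos (by linarith) hb'0
  have hcκ : c = b' * (σ + κ) := by rw [hκ]; field_simp; ring
  have hTaylor := eventually_abs_sub_half_fderiv_le hΔ_smooth
    (fderiv_eq_zero_of_isPseudoDistanceOn hΔ hθ) (show 0 < κ * m / 2 by positivity)
  obtain ⟨ρ, η, hgood, hW⟩ := exists_isGoodScale hΘ hp hθ hreg hid hml hm hF hc1 hTaylor
  obtain ⟨c₀, hc₀, C, hfar⟩ := exists_seqProb_far_le hreg.mem_self hgood.eta_pos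
  have hsmall : ∀ᶠ ε in 𝓝[>] (0 : ℝ), b * ε ^ 2 < c₀ := by
    have : Tendsto (fun ε : ℝ => b * ε ^ 2) (𝓝[>] 0) (𝓝 0) := by
      have h : Continuous fun ε : ℝ => b * ε ^ 2 := by fun_prop
      simpa using (h.tendsto 0).mono_left nhdsWithin_le_nhds
    exact this.eventually (gt_mem_nhds hc₀)
  filter_upwards [hsmall, self_mem_nhdsWithin] with ε hε hε0
  have hε2 : 0 < ε ^ 2 := pow_pos hε0 2
  filter_upwards [eventually_add_le_exp (C := C) (Fintype.card Ω) hε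
    (mul_lt_mul_of_pos_right hbb' hε2), eventually_gt_atTop 0] with N hN hN0
  refine (errorProb_le_of_near hreg.mem_self (hfar N) fun x hx hnear hΔx => ?_).trans hN
  refine le_trans ?_ (hgood.half_fisherForm_le_relEntropy hp hN0 hx hnear)
  have h1 := hW (hgood.mem_ball N hN0 x hx hnear)
  set v := ml N x - θ
  have h2 : |Δ (ml N x) θ - Δ θ θ - fderiv ℝ (fderiv ℝ (fun s => Δ s θ)) θ v v / 2| ≤
    κ * m / 2 * ‖v‖ ^ 2 := h1
  have h3 := (abs_le.1 h2).2
  rw [hΔ.self_eq_zero θ hmem] at h3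
  have h4 : ε ^ 2 ≤ (σ + κ) / 2 * fisherForm p θ v := by
    nlinarith [hHF v, mul_le_mul_of_nonneg_left (hF v) hκ0.le]
  rw [hcκ]
  have := mul_le_mul_of_nonneg_left h4 hb'0.le
  linarith

/-- The empirical distributions near `p θ` for which the maximum likelihood estimate of `θ` has
loss greater than `δ`. -/
def errorTypes (p : EuclideanSpace ℝ (Fin k) → Ω → ℝ)
    (Δ : EuclideanSpace ℝ (Fin k) → EuclideanSpace ℝ (Fin k) → ℝ)
    (θ : EuclideanSpace ℝ (Fin k)) (ρ η δ : ℝ) : Set (Ω → ℝ) :=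
  {q | q ∈ stdSimplex ℝ Ω ∧ (∀ x, p θ x = 0 → q x = 0) ∧ (∀ x, |q x - p θ x| < η) ∧
    ∃ s ∈ Metric.ball θ ρ, (∀ t ∈ Metric.ball θ ρ, logLik p q t ≤ logLik p q s) ∧ δ < Δ s θ}

theorem abs_logLik_sub_le {c ρ η : ℝ} (h : IsGoodScale Θ p θ ml c ρ η) {q q' : Ω → ℝ} {r : ℝ}
    (hr : ∀ x, |q x - q' x| ≤ r) {t : EuclideanSpace ℝ (Fin k)} (ht : t ∈ Metric.ball θ ρ) :
    |logLik p q t - logLik p q' t| ≤ r * ∑ x, (|Real.log (p θ x)| + 1) := by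
  unfold logLik
  rw [← Finset.sum_sub_distrib, Finset.mul_sum]
  refine (Finset.abs_sum_le_sum_abs _ _).trans (Finset.sum_le_sum fun x _ => ?_)
  rw [← sub_mul, abs_mul]
  exact mul_le_mul (hr x) (h.abs_log_le t ht x) (abs_nonneg _) ((abs_nonneg _).trans (hr x))

/-- Under an error type, the maximum likelihood estimator errs with high probability. -/
theorem IsGoodScale.tendsto_seqProb_not {c ρ η : ℝ} (h : IsGoodScale Θ p θ ml c ρ η)
    (hc : 0 < c) {m : ℝ} (hm : 0 < m) (hF : ∀ v, m * ‖v‖ ^ 2 ≤ fisherForm p θ v)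
    (hΔ_cont : ContinuousOn (fun s => Δ s θ) Θ) (hpθ : ∀ x, 0 ≤ p θ x)
    {δ : ℝ} {q : Ω → ℝ} (hq : q ∈ errorTypes p Δ θ ρ η δ) :
    Tendsto (fun N => seqProb q N (fun x => ¬ δ < Δ (ml N x) θ)) atTop (𝓝 0) := by
  obtain ⟨hq1, hsupp, hnear, s₀, hs₀, hmax, hδ⟩ := hq
  have hcont : ContinuousAt (fun s => Δ s θ) s₀ :=
    hΔ_cont.continuousAt (mem_of_superset (Metric.isOpen_ball.mem_nhds hs₀) h.subset)
  obtain ⟨r, hr, hball⟩ := Metric.eventually_nhds_iff_ball.1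
    (hcont.eventually (lt_mem_nhds hδ))
  set M := ∑ x, (|Real.log (p θ x)| + 1) with hM
  have hM0 : 0 ≤ M := Finset.sum_nonneg fun x _ => by positivity
  have hev1 : ∀ᶠ η' in 𝓝[>] (0 : ℝ), ∀ x, |q x - p θ x| + η' < η := by
    rw [eventually_all]
    intro x
    have : Tendsto (fun η' : ℝ => |q x - p θ x| + η') (𝓝[>] 0) (𝓝 |q x - p θ x|) := by
      have h : Continuous fun η' : ℝ => |q x - p θ x| + η' := by fun_prop
      simpa using (h.tendsto 0).mono_left nhdsWithin_le_nhds
    exact this.eventually (gt_mem_nhds (hnear x))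
  have hev2 : ∀ᶠ η' in 𝓝[>] (0 : ℝ), 2 * (η' * M) < c / 2 * (m * r ^ 2) := by
    have : Tendsto (fun η' : ℝ => 2 * (η' * M)) (𝓝[>] 0) (𝓝 0) := by
      have h : Continuous fun η' : ℝ => 2 * (η' * M) := by fun_prop
      simpa using (h.tendsto 0).mono_left nhdsWithin_le_nhds
    exact this.eventually (gt_mem_nhds (by positivity))
  -- If `freq x` is `η'`-close to `q`, log-likelihoods move by at most `η' M` at each of the two
  -- maximizers. Strong concavity then puts them within `r`, where the loss still exceeds `δ`.
  obtain ⟨η', ⟨e1, e2⟩, hη'⟩ := ((hev1.and hev2).and self_mem_nhdsWithin).exists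
  refine squeeze_zero' (Eventually.of_forall fun N => seqProb_nonneg hq1.1 N _) ?_
    (tendsto_seqProb_far hq1 hη')
  filter_upwards [eventually_gt_atTop 0] with N hN
  refine seqProb_mono hq1.1 fun x hx hΔx => ?_
  by_contra! hcon
  apply hΔx
  have hx' : ∀ i, 0 < p θ (x i) := fun i =>
    lt_of_le_of_ne (hpθ _) fun h0 => (hx i).ne' (hsupp _ h0.symm)
  have hnear' : ∀ y, |freq x y - p θ y| < η := fun y =>
    (abs_sub_le _ (q y) _).trans_lt (by linarith [hcon y, e1 y])
  have hmem := h.mem_ball N hN x hx' hnear'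
  refine hball _ ?_
  have h1 := h.logLik_le _ hnear' _ hmem (h.isMax N hN x hx' hnear') s₀ hs₀
  have h2 := hmax _ hmem
  have h3 := abs_le.1 (abs_logLik_sub_le h (fun y => (hcon y).le) hmem)
  have h4 := abs_le.1 (abs_logLik_sub_le h (fun y => (hcon y).le) hs₀)
  rw [← hM] at h3 h4
  have h5 := hF (s₀ - ml N x)
  rw [Metric.mem_ball, dist_comm, dist_eq_norm]
  have h6 : c / 2 * (m * ‖s₀ - ml N x‖ ^ 2) < c / 2 * (m * r ^ 2) := by
    have := mul_le_mul_of_nonneg_left h5 (show 0 ≤ c / 2 by linarith)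
    linarith [h3.1, h3.2, h4.1, h4.2]
  have h7 := lt_of_mul_lt_mul_left (lt_of_mul_lt_mul_left h6 (by linarith)) hm.le
  exact lt_of_pow_lt_pow_left₀ 2 hr.le h7

/-- For small thresholds the exponent of the error probability of a maximum likelihood estimator
exists as a limit. -/
theorem IsMaxLikelihoodEstimator.eventually_exists_tendsto (hΘ : IsCompact Θ)
    (hp : IsSmoothModel Θ p) (hθ : θ ∈ interior Θ) (hreg : IsRegularAt p θ)
    (hΔ_cont : ContinuousOn (fun s => Δ s θ) Θ)
    (hid : Identifiable Θ p) (hml : IsMaxLikelihoodEstimator Θ p ml)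
    (hu : IsUnit (fisherMatrix p θ)) {b : ℝ}
    (hlower : ∀ᶠ ε in 𝓝[>] (0 : ℝ), ∀ᶠ N : ℕ in atTop,
      Real.exp (-(b * ε ^ 2 * N)) ≤ errorProb p Δ ml θ (ε ^ 2) N) :
    ∀ᶠ ε in 𝓝[>] (0 : ℝ), ∃ l : EReal,
      Tendsto (fun N : ℕ => scaledLogError p Δ ml θ ε N) atTop (𝓝 l) := by
  obtain ⟨m, hm, hF⟩ := exists_pos_mul_norm_sq_le_fisherForm hreg.mem_self.1 hu
  obtain ⟨ρ, η, hgood, -⟩ := exists_isGoodScale hΘ hp hθ hreg hid hml hm hF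
    (show (1 / 2 : ℝ) < 1 by norm_num) univ_mem
  obtain ⟨c₀, hc₀, C, hfar⟩ := exists_seqProb_far_le hreg.mem_self hgood.eta_pos
  have hsmall : ∀ᶠ ε in 𝓝[>] (0 : ℝ), b * ε ^ 2 < c₀ := by
    have : Tendsto (fun ε : ℝ => b * ε ^ 2) (𝓝[>] 0) (𝓝 0) := by
      have h : Continuous fun ε : ℝ => b * ε ^ 2 := by fun_prop
      simpa using (h.tendsto 0).mono_left nhdsWithin_le_nhds
    exact this.eventually (gt_mem_nhds hc₀)
  filter_upwards [hlower, hsmall, self_mem_nhdsWithin] with ε hlow hε hε0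
  set R := (fun q => relEntropy q (p θ)) '' errorTypes p Δ θ ρ η (ε ^ 2) with hR
  have hupper : ∀ E : ℝ, (∀ r ∈ R, E ≤ r) → ∀ E' < E, E' < c₀ → ∀ᶠ N : ℕ in atTop,
      errorProb p Δ ml θ (ε ^ 2) N ≤ Real.exp (-(E' * N)) := by
    intro E hE E' hE' hE'c
    filter_upwards [eventually_add_le_exp (C := C) (Fintype.card Ω) hE'c hE',
      eventually_gt_atTop 0] with N hN hN0
    refine (errorProb_le_of_near hreg.mem_self (hfar N) fun x hx hnear hΔx => ?_).trans hN
    exact hE _ ⟨freq x, ⟨freq_mem_stdSimplex hN0 x, fun y hy => freq_eq_zero_of_pos hx hy, hnear,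
      ml N x, hgood.mem_ball N hN0 x hx hnear, hgood.isMax N hN0 x hx hnear, hΔx⟩, rfl⟩
  -- A larger bound would contradict `hlow`. Hence `R` is nonempty and its infimum lies below `c₀`,
  -- so atypical sequences do not affect the exponent.
  have hbound : ∀ E : ℝ, (∀ r ∈ R, E ≤ r) → E ≤ b * ε ^ 2 := by
    intro E hE
    by_contra! hcon
    obtain ⟨E', h1, h2⟩ := exists_between (lt_min hcon hε)
    obtain ⟨N, hN1, hN2, hN0⟩ := ((hupper E hE E' (h2.trans_le (min_le_left _ _))
      (h2.trans_le (min_le_right _ _))).and (hlow.and (eventually_gt_atTop 0))).exists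
    have h3 := Real.exp_le_exp.1 (hN2.trans hN1)
    have hN' : (0 : ℝ) < N := Nat.cast_pos.2 hN0
    nlinarith
  have hne : R.Nonempty := by
    by_contra hcon
    have := hbound (b * ε ^ 2 + 1) fun r hr => (hcon ⟨r, hr⟩).elim
    linarith
  have hbdd : BddBelow R := ⟨0, by
    rintro _ ⟨q, hq, rfl⟩
    exact relEntropy_nonneg hq.1 hreg.mem_self hq.2.1⟩
  have hinf : ∀ r ∈ R, sInf R ≤ r := fun r hr => csInf_le hbdd hr
  refine ⟨_, tendsto_scaledLogError hε0 (E := sInf R) (fun E' hE' => ?_) fun E' hE' =>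
    hupper _ hinf E' hE' (hE'.trans_le ((hbound _ hinf).trans hε.le))⟩
  obtain ⟨_, ⟨q, hq, rfl⟩, hqE⟩ := exists_lt_of_csInf_lt hne hE'
  exact eventually_exp_le_seqProb hq.1 hreg.mem_self hq.2.1
    (hgood.tendsto_seqProb_not (by norm_num) hm hF hΔ_cont hreg.mem_self.1 hq) hqE

end MaxLikelihood

end ErrorExponent

/-! ### Passage to the limit in `ε` -/

theorem theorem2 {k : ℕ} {Ω : Type*} [Fintype Ω]
    (Θ : Set (EuclideanSpace ℝ (Fin k))) (hΘ : IsCompact Θ)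
    (p : EuclideanSpace ℝ (Fin k) → Ω → ℝ) (hp : ErrorExponent.IsSmoothModel Θ p)
    (Δ : EuclideanSpace ℝ (Fin k) → EuclideanSpace ℝ (Fin k) → ℝ)
    (hΔ : ErrorExponent.IsPseudoDistanceOn Θ Δ)
    (hΔ_cont : ∀ t ∈ Θ, ContinuousOn (fun s => Δ s t) Θ)
    (θ : EuclideanSpace ℝ (Fin k)) (hθ : θ ∈ interior Θ)
    (hp_supp : ∀ x, p θ x = 0 → ∀ᶠ t in 𝓝 θ, p t x = 0)
    (hΔ_smooth : ContDiffAt ℝ 2 (fun s => Δ s θ) θ)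
    (hH : ErrorExponent.hesseMatrix Δ θ ≠ 0) :
    (∀ est : (N : ℕ) → (Fin N → Ω) → EuclideanSpace ℝ (Fin k),
      ErrorExponent.IsEstimator Θ est → ErrorExponent.IsConsistent Θ p Δ est →
      ErrorExponent.exponentBound (ErrorExponent.hesseMatrix Δ θ)
          (ErrorExponent.fisherMatrix p θ) ≤
        liminf (fun ε : ℝ =>
          liminf (fun N : ℕ => ErrorExponent.scaledLogError p Δ est θ ε N) atTop) (𝓝[>] 0)) ∧
    (ErrorExponent.Identifiable Θ p →
      ∀ ml : (N : ℕ) → (Fin N → Ω) → EuclideanSpace ℝ (Fin k),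
        ErrorExponent.IsMaxLikelihoodEstimator Θ p ml →
        ErrorExponent.IsConsistent Θ p Δ ml ∧
        (IsUnit (ErrorExponent.fisherMatrix p θ) →
          ∃ L : ℝ → EReal,
            (∀ᶠ ε in 𝓝[>] (0 : ℝ),
              Tendsto (fun N : ℕ => ErrorExponent.scaledLogError p Δ ml θ ε N) atTop
                (𝓝 (L ε))) ∧
            Tendsto L (𝓝[>] 0)
              (𝓝 (ErrorExponent.exponentBound (ErrorExponent.hesseMatrix Δ θ)
                (ErrorExponent.fisherMatrix p θ))))) := by
  open ErrorExponent in
  have hreg := hp.isRegularAt hθ hp_supp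
  have hcancel : ∀ b ε : ℝ, 0 < ε → -(b * ε ^ 2 / ε ^ 2) = -b := fun b ε hε => by field_simp
  have hlow : ∀ est : (N : ℕ) → (Fin N → Ω) → EuclideanSpace ℝ (Fin k),
      IsEstimator Θ est → IsConsistent Θ p Δ est →
      0 < maxEigenvalue (sandwich (hesseMatrix Δ θ) (fisherMatrix p θ)) → ∀ r : ℝ,
      (r : EReal) < exponentBound (hesseMatrix Δ θ) (fisherMatrix p θ) →
      ∀ᶠ ε in 𝓝[>] (0 : ℝ),
        (r : EReal) ≤ liminf (fun N : ℕ => scaledLogError p Δ est θ ε N) atTop := by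
    intro est hest hcons hσ r hr
    rw [exponentBound_of_pos hσ, EReal.coe_lt_coe_iff] at hr
    filter_upwards [hcons.eventually_exp_le_errorProb hΘ hp hΔ hΔ_cont hθ hreg hΔ_smooth hest hσ
      (b := -r) (by linarith), self_mem_nhdsWithin] with ε hε hε0
    refine le_liminf_of_le (by isBoundedDefault) ?_
    have := eventually_le_scaledLogError hε0 hε
    rwa [hcancel _ _ hε0, neg_neg] at this
  refine ⟨fun est hest hcons => ?_, fun hid ml hml => ?_⟩
  · rcases le_or_gt (maxEigenvalue (sandwich (hesseMatrix Δ θ) (fisherMatrix p θ))) 0 with hσ | hσ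
    · rw [exponentBound_of_nonpos hσ]
      exact bot_le
    · by_contra! hcon
      obtain ⟨r, hr1, hr2⟩ := EReal.lt_iff_exists_real_btwn.1 hcon
      exact absurd (le_liminf_of_le (by isBoundedDefault) (hlow est hest hcons hσ r hr2))
        (not_le.2 hr1)
  · have hcons := hml.isConsistent hΘ hp hΔ hΔ_cont hid
    refine ⟨hcons, fun hu => ?_⟩
    have hest : IsEstimator Θ ml := fun N x => (hml N x).1
    have hσ := maxEigenvalue_sandwich_pos (posSemidef_hesseMatrix hΔ hθ hΔ_smooth)
      (posSemidef_fisherMatrix hreg.mem_self.1) hu hH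
    have hlim := hml.eventually_exists_tendsto hΘ hp hθ hreg
      (hΔ_cont θ (interior_subset hθ)) hid hu (hcons.eventually_exp_le_errorProb hΘ hp hΔ hΔ_cont
        hθ hreg hΔ_smooth hest hσ (lt_add_one _))
    -- The inner `liminf` serves as `L`: it is defined for every `ε` and equals the limit whenever
    -- that exists.
    have hlim' : ∀ᶠ ε in 𝓝[>] (0 : ℝ),
        Tendsto (fun N : ℕ => scaledLogError p Δ ml θ ε N) atTop
          (𝓝 (liminf (fun N : ℕ => scaledLogError p Δ ml θ ε N) atTop)) :=
      hlim.mono fun ε ⟨l, hl⟩ => by rwa [hl.liminf_eq]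
    refine ⟨_, hlim', tendsto_order.2 ⟨fun a ha => ?_, fun a ha => ?_⟩⟩
    · obtain ⟨r, har, hr⟩ := EReal.lt_iff_exists_real_btwn.1 ha
      exact (hlow ml hest hcons hσ r hr).mono fun ε hε => har.trans_le hε
    · obtain ⟨r, hr, har⟩ := EReal.lt_iff_exists_real_btwn.1 ha
      rw [exponentBound_of_pos hσ, EReal.coe_lt_coe_iff] at hr
      filter_upwards [hlim', hml.eventually_errorProb_le hΘ hp hΔ hθ hreg hΔ_smooth hH hid hu
        (b := -r) (by linarith), self_mem_nhdsWithin] with ε hε1 hε2 hε0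
      refine (le_of_tendsto hε1 ?_).trans_lt har
      have := eventually_scaledLogError_le hε0 hε2
      rwa [hcancel _ _ hε0, neg_neg] at this
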